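/- Let $K$ be a field of characteristic $p>0$, let $P_n=K[x_1,\dots,x_n]$, and let $\mathcal D(P_n)\subseteq \mathrm{End}_K(P_n)$ be the ring of $K$-linear differential operators on $P_n$. For $\beta\in\mathbb N^n$ let $\partial^{[\beta]}=\prod_i \frac{\partial_i^{\beta_i}}{\beta_i!}$ be the divided power operator $x^\gamma\mapsto\prod_i\binom{\gamma_i}{\beta_i}\,x^{\gamma-\beta}$. The canonical filtration of $\mathcal D(P_n)$ is $F_i=\sum_{|\alpha|+|\beta|\le i}K x^\alpha\partial^{[\beta]}$, $i\ge 0$. A filtration of standard type on $\mathcal D(P_n)$ is an algebra filtration $F'=\{F'_i\}_{i\ge 0}$ by finite dimensional subspaces that is equivalent to $F$, i.e. there are natural numbers $a,c>0$ and $b,d\geq 0$ with $F'_i\subseteq F_{ai+b}$ and $F_i\subseteq F'_{ci+d}$ for all $i\gg 0$. A filtration of standard type on a finitely generated left $\mathcal D(P_n)$-module $M$ is a filtration $\{M_i:=F'_iM_0\}$, where $F'$ is a filtration of standard type on $\mathcal D(P_n)$ and $M_0$ is a finite dimensional $K$-subspace with $\mathcal D(P_n)M_0=M$. For $f:\mathbb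 N\to\mathbb N$ put $\gamma(f)=\inf\{r\in\mathbb R : f(i)\le i^r \text{ for } i\gg 0\}$. The dimension of $M$ is $\mathrm{Dim}(M)=\gamma(i\mapsto\dim_K M_i)$ for any filtration of standard type $\{M_i\}$ on $M$ (it does not depend on the choice). The module $M$ is called holonomic if there are a filtration of standard type $\{M_i\}$ on $M$ and a polynomial $q\in\mathbb Q[t]$ of degree $n$ such that $\dim_K M_i\le q(i)$ for all $i\gg 0$. Theorem. Let $M$ be a nonzero finitely presented left $\mathcal D(P_n)$-module. The following statements are equivalent: 1. $M$ is a holonomic $\mathcal D(P_n)$-module. 2. $\mathrm{Dim}(M)=n$. 3. $\mathrm{Dim}(M)<n+1$. -/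

import Mathlib

noncomputable section

open Filter

/-! ### The ring of differential operators of a commutative algebra -/

section DifferentialOperators

variable (K A : Type*) [Field K] [CommRing A] [Algebra K A]

/-- The `K`-linear differential operators of order at most `i` on the commutative `K`-algebra `A`:
order `0` means commuting with all multiplications, i.e. `A`-linear, and `f` has order at most
`i + 1` if `f ∘ a - a ∘ f` has order at most `i` for every `a : A`. -/
def diffOpOrder : ℕ → Submodule K (Module.End K A)
  | 0 =>
    { carrier := {f | ∀ a : A, f * LinearMap.mulLeft K a - LinearMap.mulLeft K a * f = 0}
      add_mem' := by
        intro f g hf hg a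
        have : (f + g) * LinearMap.mulLeft K a - LinearMap.mulLeft K a * (f + g)
          = (f * LinearMap.mulLeft K a - LinearMap.mulLeft K a * f)
            + (g * LinearMap.mulLeft K a - LinearMap.mulLeft K a * g) := by noncomm_ring
        rw [this, hf a, hg a, add_zero]
      zero_mem' := by intro a; simp
      smul_mem' := by
        intro c f hf a
        rw [smul_mul_assoc, mul_smul_comm, ← smul_sub, hf a, smul_zero] }
  | i + 1 =>
    { carrier := {f | ∀ a : A,
        f * LinearMap.mulLeft K a - LinearMap.mulLeft K a * f ∈ diffOpOrder i}
      add_mem' := by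
        intro f g hf hg a
        have : (f + g) * LinearMap.mulLeft K a - LinearMap.mulLeft K a * (f + g)
          = (f * LinearMap.mulLeft K a - LinearMap.mulLeft K a * f)
            + (g * LinearMap.mulLeft K a - LinearMap.mulLeft K a * g) := by noncomm_ring
        rw [this]
        exact add_mem (hf a) (hg a)
      zero_mem' := by intro a; simp
      smul_mem' := by
        intro c f hf a
        rw [smul_mul_assoc, mul_smul_comm, ← smul_sub]
        exact Submodule.smul_mem _ c (hf a) }

variable {K A}

theorem mem_diffOpOrder_zero {f : Module.End K A} : f ∈ diffOpOrder K A 0 ↔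
    ∀ a : A, f * LinearMap.mulLeft K a - LinearMap.mulLeft K a * f = 0 := by
  rw [diffOpOrder]; rfl

theorem mem_diffOpOrder_succ {i : ℕ} {f : Module.End K A} : f ∈ diffOpOrder K A (i + 1) ↔
    ∀ a : A, f * LinearMap.mulLeft K a - LinearMap.mulLeft K a * f ∈ diffOpOrder K A i := by
  rw [diffOpOrder]; rfl

theorem diffOpOrder_le_succ (i : ℕ) : diffOpOrder K A i ≤ diffOpOrder K A (i + 1) := by
  induction i with
  | zero =>
    intro f hf
    rw [mem_diffOpOrder_succ]
    intro a
    rw [mem_diffOpOrder_zero.1 hf a]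
    exact zero_mem _
  | succ i ih =>
    intro f hf
    rw [mem_diffOpOrder_succ]
    intro a
    exact ih (mem_diffOpOrder_succ.1 hf a)

theorem diffOpOrder_mono : Monotone (diffOpOrder K A) :=
  monotone_nat_of_le_succ diffOpOrder_le_succ

theorem mulLeft_mem_diffOpOrder (a : A) (i : ℕ) :
    LinearMap.mulLeft K a ∈ diffOpOrder K A i := by
  refine diffOpOrder_mono (Nat.zero_le i) (mem_diffOpOrder_zero.2 fun b => ?_)
  ext x
  simp [mul_left_comm]

theorem mul_mem_diffOpOrder : ∀ (i j : ℕ) {f g : Module.End K A}, f ∈ diffOpOrder K A i →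
    g ∈ diffOpOrder K A j → f * g ∈ diffOpOrder K A (i + j) := by
  have key : ∀ (f g : Module.End K A) (a : A),
      f * g * LinearMap.mulLeft K a - LinearMap.mulLeft K a * (f * g)
        = f * (g * LinearMap.mulLeft K a - LinearMap.mulLeft K a * g)
          + (f * LinearMap.mulLeft K a - LinearMap.mulLeft K a * f) * g := by
    intro f g a
    rw [mul_sub, sub_mul, mul_assoc, mul_assoc, mul_assoc]
    abel
  intro i
  induction i with
  | zero =>
    intro j
    induction j with
    | zero =>
      intro f g hf hg
      refine mem_diffOpOrder_zero.2 fun a => ?_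
      rw [key, mem_diffOpOrder_zero.1 hf a, mem_diffOpOrder_zero.1 hg a]
      simp
    | succ j ih =>
      intro f g hf hg
      refine mem_diffOpOrder_succ.2 fun a => ?_
      rw [key, mem_diffOpOrder_zero.1 hf a, zero_mul, add_zero]
      exact ih hf (mem_diffOpOrder_succ.1 hg a)
  | succ i ih =>
    intro j
    induction j with
    | zero =>
      intro f g hf hg
      refine mem_diffOpOrder_succ.2 fun a => ?_
      rw [key, mem_diffOpOrder_zero.1 hg a, mul_zero, zero_add]
      exact ih 0 (mem_diffOpOrder_succ.1 hf a) hg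
    | succ j ihj =>
      intro f g hf hg
      refine mem_diffOpOrder_succ.2 fun a => ?_
      rw [key]
      refine add_mem ?_ ?_
      · exact ihj hf (mem_diffOpOrder_succ.1 hg a)
      · have := ih (j + 1) (mem_diffOpOrder_succ.1 hf a) hg
        have e : i + 1 + j = i + (j + 1) := by omega
        change _ ∈ diffOpOrder K A (i + 1 + j)
        rwa [e]

variable (K A) in
/-- The ring of `K`-linear differential operators on `A`, a subalgebra of `End_K(A)`. -/
def diffOp : Subalgebra K (Module.End K A) where
  carrier := {f | ∃ i, f ∈ diffOpOrder K A i}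
  mul_mem' := by
    rintro f g ⟨i, hf⟩ ⟨j, hg⟩
    exact ⟨i + j, mul_mem_diffOpOrder i j hf hg⟩
  add_mem' := by
    rintro f g ⟨i, hf⟩ ⟨j, hg⟩
    exact ⟨i + j, add_mem (diffOpOrder_mono (Nat.le_add_right i j) hf)
      (diffOpOrder_mono (Nat.le_add_left j i) hg)⟩
  algebraMap_mem' := by
    intro c
    refine ⟨0, mem_diffOpOrder_zero.2 fun a => ?_⟩
    ext x
    simp

end DifferentialOperators

/-! ### The polynomial algebra and the canonical filtration -/

section Canonical

variable (K : Type*) [Field K] (n : ℕ)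

/-- `D(P_n)`, the ring of differential operators on `P_n = K[x_1, …, x_n]`. -/
abbrev DPn : Type _ := diffOp K (MvPolynomial (Fin n) K)

/-- The divided power operator `∂^[β] = ∏ i, ∂_i^{β i} / (β i)!` on `P_n`, in any characteristic:
`x^γ` is sent to `∏ i, binom (γ i) (β i) • x^(γ - β)`.  (The product of binomials vanishes unless
`β ≤ γ`.) -/
def dividedDeriv (β : Fin n →₀ ℕ) : Module.End K (MvPolynomial (Fin n) K) :=
  (MvPolynomial.basisMonomials (Fin n) K).constr K fun γ : Fin n →₀ ℕ =>
    MvPolynomial.monomial (γ - β) ((∏ i, (γ i).choose (β i) : ℕ) : K)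

variable {n}

theorem dividedDeriv_monomial (β γ : Fin n →₀ ℕ) :
    dividedDeriv K n β (MvPolynomial.monomial γ 1) =
      MvPolynomial.monomial (γ - β) ((∏ i, (γ i).choose (β i) : ℕ) : K) := by
  have := (MvPolynomial.basisMonomials (Fin n) K).constr_basis K (fun γ : Fin n →₀ ℕ =>
    MvPolynomial.monomial (γ - β) ((∏ i, (γ i).choose (β i) : ℕ) : K)) γ
  simpa [dividedDeriv] using this

theorem dividedDeriv_comm_X (β : Fin n →₀ ℕ) (j : Fin n) :
    dividedDeriv K n β * LinearMap.mulLeft K (MvPolynomial.X j)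
        - LinearMap.mulLeft K (MvPolynomial.X j) * dividedDeriv K n β =
      if β j = 0 then 0 else dividedDeriv K n (β - Finsupp.single j 1) := by
  refine (MvPolynomial.basisMonomials (Fin n) K).ext fun γ => ?_
  have hX : ∀ (δ : Fin n →₀ ℕ) (c : K), MvPolynomial.X j * MvPolynomial.monomial δ c =
      MvPolynomial.monomial (δ + Finsupp.single j 1) c := by
    intro δ c
    rw [MvPolynomial.X, MvPolynomial.monomial_mul, one_mul, add_comm]
  have hprod : ∀ u v : Fin n →₀ ℕ, ∏ i, (u i).choose (v i) =
      (u j).choose (v j) * ∏ i ∈ Finset.univ.erase j, (u i).choose (v i) := fun u v =>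
    (Finset.mul_prod_erase Finset.univ (fun i => (u i).choose (v i)) (Finset.mem_univ j)).symm
  have herase : ∀ u v u' v' : Fin n →₀ ℕ, (∀ i, i ≠ j → u i = u' i ∧ v i = v' i) →
      ∏ i ∈ Finset.univ.erase j, (u i).choose (v i) =
        ∏ i ∈ Finset.univ.erase j, (u' i).choose (v' i) := by
    intro u v u' v' h
    refine Finset.prod_congr rfl fun i hi => ?_
    rw [(h i (Finset.ne_of_mem_erase hi)).1, (h i (Finset.ne_of_mem_erase hi)).2]
  have hs : ∀ i, i ≠ j → Finsupp.single j 1 i = 0 := fun i hi => by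
    rw [Finsupp.single_apply, if_neg (Ne.symm hi)]
  rw [MvPolynomial.coe_basisMonomials, LinearMap.sub_apply, Module.End.mul_apply,
    Module.End.mul_apply, LinearMap.mulLeft_apply, LinearMap.mulLeft_apply, hX,
    dividedDeriv_monomial, dividedDeriv_monomial, hX, hprod, hprod γ β,
    herase (γ + Finsupp.single j 1) β γ β (fun i hi => by simp [hs i hi])]
  have hj : (γ + Finsupp.single j 1 : Fin n →₀ ℕ) j = γ j + 1 := by simp
  rw [hj]
  split_ifs with h0
  · have : γ + Finsupp.single j 1 - β = γ - β + Finsupp.single j 1 := by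
      ext i
      by_cases hi : i = j
      · subst hi; simp [h0]
      · simp [hs i hi]
    rw [this, h0]
    simp
  · obtain ⟨b, hb⟩ := Nat.exists_eq_succ_of_ne_zero h0
    have e1 : γ + Finsupp.single j 1 - β = γ - (β - Finsupp.single j 1) := by
      ext i
      by_cases hi : i = j
      · subst hi; simp [hb]
      · simp [hs i hi]
    have hbj : (β - Finsupp.single j 1 : Fin n →₀ ℕ) j = b := by simp [hb]
    rw [dividedDeriv_monomial, hprod, hbj, e1,
      herase γ (β - Finsupp.single j 1) γ β (fun i hi => by simp [hs i hi]), hb,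
      Nat.choose_succ_succ]
    by_cases hle : β j ≤ γ j
    · have e2 : γ - β + Finsupp.single j 1 = γ - (β - Finsupp.single j 1) := by
        ext i
        by_cases hi : i = j
        · subst hi; simp; omega
        · simp [hs i hi]
      rw [e2, ← map_sub]
      congr 1
      push_cast
      ring
    · have : (γ j).choose b.succ = 0 := Nat.choose_eq_zero_of_lt (by omega)
      rw [this]
      simp

theorem mem_diffOpOrder_of_X {f : Module.End K (MvPolynomial (Fin n) K)} {i : ℕ}
    (h : ∀ j, f * LinearMap.mulLeft K (MvPolynomial.X j)
      - LinearMap.mulLeft K (MvPolynomial.X j) * f ∈ diffOpOrder K _ i) :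
    f ∈ diffOpOrder K _ (i + 1) := by
  refine mem_diffOpOrder_succ.2 fun a => ?_
  induction a using MvPolynomial.induction_on with
  | C c =>
    have : f * LinearMap.mulLeft K (MvPolynomial.C c)
        - LinearMap.mulLeft K (MvPolynomial.C c) * f = 0 := by
      refine LinearMap.ext fun x => ?_
      simp [← MvPolynomial.smul_eq_C_mul]
    rw [this]
    exact zero_mem _
  | add a b ha hb =>
    have : f * LinearMap.mulLeft K (a + b) - LinearMap.mulLeft K (a + b) * f
        = (f * LinearMap.mulLeft K a - LinearMap.mulLeft K a * f)
          + (f * LinearMap.mulLeft K b - LinearMap.mulLeft K b * f) := by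
      refine LinearMap.ext fun x => ?_
      simp [add_mul]
      abel
    rw [this]
    exact add_mem ha hb
  | mul_X a j ha =>
    have : f * LinearMap.mulLeft K (a * MvPolynomial.X j)
          - LinearMap.mulLeft K (a * MvPolynomial.X j) * f
        = (f * LinearMap.mulLeft K a - LinearMap.mulLeft K a * f)
            * LinearMap.mulLeft K (MvPolynomial.X j)
          + LinearMap.mulLeft K a * (f * LinearMap.mulLeft K (MvPolynomial.X j)
            - LinearMap.mulLeft K (MvPolynomial.X j) * f) := by
      refine LinearMap.ext fun x => ?_
      simp [mul_sub]
    rw [this]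
    refine add_mem ?_ ?_
    · exact mul_mem_diffOpOrder i 0 ha (mulLeft_mem_diffOpOrder _ 0)
    · have := mul_mem_diffOpOrder 0 i (mulLeft_mem_diffOpOrder a 0) (h j)
      rwa [Nat.zero_add] at this

theorem dividedDeriv_mem_diffOpOrder : ∀ (i : ℕ) (β : Fin n →₀ ℕ), β.degree ≤ i →
    dividedDeriv K n β ∈ diffOpOrder K _ (i + 1) := by
  intro i
  induction i with
  | zero =>
    intro β hβ
    refine mem_diffOpOrder_of_X K fun j => ?_
    have h0 : β = 0 := (Finsupp.degree_eq_zero_iff β).1 (Nat.le_zero.1 hβ)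
    rw [dividedDeriv_comm_X, h0, if_pos (by simp)]
    exact zero_mem _
  | succ i ih =>
    intro β hβ
    refine mem_diffOpOrder_of_X K fun j => ?_
    rw [dividedDeriv_comm_X]
    split_ifs with h0
    · exact zero_mem _
    · refine ih _ ?_
      have hle : Finsupp.single j 1 ≤ β := by
        rw [Finsupp.single_le_iff]; omega
      have : (β - Finsupp.single j 1).degree + 1 = β.degree := by
        conv_rhs => rw [← tsub_add_cancel_of_le hle]
        rw [map_add, Finsupp.degree_single]
      omega

/-- The element `x^α ∂^[β]` of `D(P_n)`. -/
def canonicalElement (α β : Fin n →₀ ℕ) : DPn K n :=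
  ⟨LinearMap.mulLeft K (MvPolynomial.monomial α 1) * dividedDeriv K n β,
    _, mul_mem_diffOpOrder 0 _ (mulLeft_mem_diffOpOrder _ 0)
      (dividedDeriv_mem_diffOpOrder K _ β le_rfl)⟩

variable (n) in
/-- The canonical filtration of `D(P_n)`: `F_i` is the `K`-span of all `x^α ∂^[β]` with
`|α| + |β| ≤ i`. -/
def canonicalFiltration (i : ℕ) : Submodule K (DPn K n) :=
  Submodule.span K
    {d | ∃ α β : Fin n →₀ ℕ, α.degree + β.degree ≤ i ∧ d = canonicalElement K α β}

end Canonical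

/-! ### Filtrations, growth, dimension, holonomic modules -/

/-- A finite dimensional filtration of a `K`-algebra. -/
structure IsFiniteFiltration (K : Type*) {R : Type*} [Field K] [Ring R] [Algebra K R]
    (F : ℕ → Submodule K R) : Prop where
  mono : Monotone F
  exhaustive : ∀ a : R, ∃ i, a ∈ F i
  one_mem : (1 : R) ∈ F 0
  mul_mem : ∀ i j (a b : R), a ∈ F i → b ∈ F j → a * b ∈ F (i + j)
  finite : ∀ i, FiniteDimensional K (F i)

/-- Equivalence of filtrations: `F i ⊆ G (a i + b)` and `G i ⊆ F (c i + d)` for `i ≫ 0`. -/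
def FiltrationEquiv {K R : Type*} [Field K] [Ring R] [Algebra K R]
    (F G : ℕ → Submodule K R) : Prop :=
  ∃ a b c d : ℕ, 0 < a ∧ 0 < c ∧
    (∀ᶠ i in atTop, F i ≤ G (a * i + b)) ∧ (∀ᶠ i in atTop, G i ≤ F (c * i + d))

/-- A filtration of standard type of `D(P_n)`: a finite dimensional filtration which is equivalent
to the canonical filtration. -/
def IsStandardType {K : Type*} [Field K] {n : ℕ} (F : ℕ → Submodule K (DPn K n)) : Prop :=
  IsFiniteFiltration K (R := DPn K n) F ∧ FiltrationEquiv (R := DPn K n) F (canonicalFiltration K n)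

/-- The degree (growth) of a function: the infimum of all real `r` such that `f i ≤ i ^ r`
for `i ≫ 0`. -/
def growthDegree (f : ℕ → ℕ) : EReal :=
  ⨅ (r : ℝ) (_ : ∀ᶠ i in atTop, (f i : ℝ) ≤ (i : ℝ) ^ r), (r : EReal)

section Modules

variable {K : Type*} [Field K] {n : ℕ} {M : Type*} [AddCommGroup M] [Module K M]
  [Module (DPn K n) M] [IsScalarTower K (DPn K n) M]

variable (K n) in
/-- `M₀` is a finite dimensional `K`-subspace of `M` that generates `M` as a `D(P_n)`-module. -/
def IsFiniteGenerating (M₀ : Submodule K M) : Prop :=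
  FiniteDimensional K M₀ ∧ Submodule.span (DPn K n) (M₀ : Set M) = ⊤

/-- The Hilbert function `i ↦ dim_K (F i • M₀)` of the filtration of `M` that is induced by the
filtration `F` of `D(P_n)` and the subspace `M₀`; here `F i • M₀` is the `K`-span of all products
`d • m` with `d ∈ F i` and `m ∈ M₀`. -/
def hilbertFunction (F : ℕ → Submodule K (DPn K n)) (M₀ : Submodule K M) (i : ℕ) : ℕ :=
  Module.finrank K (F i • M₀ : Submodule K M)

variable (K n M) in
/-- The dimension `Dim(M)` of a finitely generated `D(P_n)`-module `M`: the degree of the Hilbert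
function of a filtration of standard type of `M`.  By `dimension_eq` below the infimum is over
equal numbers: the degree does not depend on the filtration. -/
def dimension : EReal :=
  ⨅ (F : ℕ → Submodule K (DPn K n)) (_ : IsStandardType F)
    (M₀ : Submodule K M) (_ : IsFiniteGenerating K n M₀), growthDegree (hilbertFunction F M₀)

variable (K n M) in
/-- A `D(P_n)`-module `M` is holonomic if the Hilbert function of some filtration of standard type
of `M` is bounded above by a polynomial of degree `n` for `i ≫ 0`. -/
def IsHolonomic : Prop :=
  ∃ F : ℕ → Submodule K (DPn K n), IsStandardType F ∧
    ∃ M₀ : Submodule K M, IsFiniteGenerating K n M₀ ∧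
      ∃ q : Polynomial ℚ, q.natDegree = n ∧
        ∀ᶠ i : ℕ in atTop, (hilbertFunction F M₀ i : ℚ) ≤ q.eval (i : ℚ)

theorem growthDegree_le {f g : ℕ → ℕ} {a b : ℕ} (ha : 0 < a)
    (h : ∀ᶠ i in atTop, f i ≤ g (a * i + b)) : growthDegree f ≤ growthDegree g := by
  refine le_iInf fun r => le_iInf fun hr => ?_
  have key : ∀ ε : ℝ, 0 < ε → growthDegree f ≤ ((r + ε : ℝ) : EReal) := by
    intro ε hε
    refine iInf_le_of_le (r + ε) (iInf_le_of_le ?_ le_rfl)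
    have ht : Tendsto (fun i : ℕ => a * i + b) atTop atTop :=
      tendsto_atTop_mono
      (fun i => (Nat.le_mul_of_pos_left i ha).trans (Nat.le_add_right _ _)) tendsto_id
    have hε' : Tendsto (fun i : ℕ => (i : ℝ) ^ ε) atTop atTop :=
      (tendsto_rpow_atTop hε).comp tendsto_natCast_atTop_atTop
    filter_upwards [h, ht.eventually hr, eventually_ge_atTop 1,
      hε'.eventually_ge_atTop (((a + b : ℕ) : ℝ) ^ r), hε'.eventually_ge_atTop 1]
      with i h1 h2 h3 h4 h5
    have hi : (1 : ℝ) ≤ i := by exact_mod_cast h3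
    have hir : 0 ≤ (i : ℝ) ^ r := Real.rpow_nonneg (by linarith) r
    have ha' : (1 : ℝ) ≤ a := by exact_mod_cast ha
    have hb' : (0 : ℝ) ≤ b := by positivity
    refine (Nat.cast_le.2 h1).trans (h2.trans ?_)
    rw [Real.rpow_add (by linarith)]
    rcases le_total 0 r with h0 | h0
    · calc ((a * i + b : ℕ) : ℝ) ^ r ≤ (i * (a + b : ℕ) : ℝ) ^ r := by
            refine Real.rpow_le_rpow (by positivity) ?_ h0
            push_cast
            nlinarith
        _ = (i : ℝ) ^ r * ((a + b : ℕ) : ℝ) ^ r :=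
            Real.mul_rpow (by positivity) (by positivity)
        _ ≤ _ := mul_le_mul_of_nonneg_left h4 hir
    · calc ((a * i + b : ℕ) : ℝ) ^ r ≤ (i : ℝ) ^ r := by
            refine Real.rpow_le_rpow_of_nonpos (by linarith) ?_ h0
            push_cast
            nlinarith
        _ ≤ _ := le_mul_of_one_le_right hir h5
  refine EReal.le_of_forall_lt_iff_le.1 fun z hz => ?_
  have hz' : r < z := EReal.coe_lt_coe_iff.1 hz
  simpa using key (z - r) (by linarith)

theorem exists_hilbertFunction_le {F G : ℕ → Submodule K (DPn K n)} (hF : IsStandardType F)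
    (hG : IsStandardType G) {M₀ N₀ : Submodule K M} (hM : IsFiniteGenerating K n M₀)
    (hN : IsFiniteGenerating K n N₀) : ∃ a b : ℕ, 0 < a ∧
      ∀ᶠ i in atTop, hilbertFunction F M₀ i ≤ hilbertFunction G N₀ (a * i + b) := by
  obtain ⟨hF1, a, b, -, -, ha, -, hab, -⟩ := hF
  obtain ⟨hG1, -, -, c, d, -, hc, -, hcd⟩ := hG
  -- `M₀` is contained in some `G e • N₀`
  have hmono : ∀ {i j : ℕ}, i ≤ j → G i • N₀ ≤ G j • N₀ := fun hij =>
    Submodule.smul_mono (hG1.mono hij) le_rfl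
  have hall : ∀ m : M, ∃ e, m ∈ G e • N₀ := by
    intro m
    have hm : m ∈ Submodule.span (DPn K n) (N₀ : Set M) := hN.2 ▸ Submodule.mem_top
    induction hm using Submodule.span_induction with
    | mem x hx =>
      refine ⟨0, ?_⟩
      have := Submodule.smul_mem_smul hG1.one_mem (show x ∈ N₀ from hx)
      rwa [one_smul] at this
    | zero => exact ⟨0, zero_mem _⟩
    | add x y _ _ hx hy =>
      obtain ⟨e, he⟩ := hx
      obtain ⟨e', he'⟩ := hy
      exact ⟨e + e', add_mem (hmono (Nat.le_add_right _ _) he) (hmono (Nat.le_add_left _ _) he')⟩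
    | smul s x _ hx =>
      obtain ⟨e, he⟩ := hx
      obtain ⟨l, hl⟩ := hG1.exhaustive s
      refine ⟨l + e, ?_⟩
      have h1 : s • x ∈ G l • (G e • N₀) := Submodule.smul_mem_smul hl he
      rw [← Submodule.smul_assoc, smul_eq_mul] at h1
      exact Submodule.smul_mono (Submodule.mul_le.2 fun u hu v hv => hG1.mul_mem l e u v hu hv)
        le_rfl h1
  obtain ⟨e, he⟩ : ∃ e, M₀ ≤ G e • N₀ := by
    have hfin : M₀.FG := (Submodule.fg_iff_finiteDimensional M₀).2 hM.1
    obtain ⟨S, hS⟩ := hfin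
    choose l hl using hall
    refine ⟨S.sup l, ?_⟩
    rw [← hS, Submodule.span_le]
    intro x hx
    exact hmono (Finset.le_sup hx) (hl x)
  refine ⟨c * a, c * b + d + e, Nat.mul_pos hc ha, ?_⟩
  have ht : Tendsto (fun i : ℕ => a * i + b) atTop atTop :=
    tendsto_atTop_mono
      (fun i => (Nat.le_mul_of_pos_left i ha).trans (Nat.le_add_right _ _)) tendsto_id
  filter_upwards [hab, ht.eventually hcd] with i h1 h2
  have hle : F i • M₀ ≤ G (c * a * i + (c * b + d + e)) • N₀ := by
    calc F i • M₀ ≤ G (c * (a * i + b) + d) • (G e • N₀) :=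
          Submodule.smul_mono (h1.trans h2) he
      _ = (G (c * (a * i + b) + d) * G e) • N₀ := (Submodule.smul_assoc _ _ _).symm
      _ ≤ _ := Submodule.smul_mono (Submodule.mul_le.2 fun u hu v hv => by
          have := hG1.mul_mem _ e u v hu hv
          have e1 : c * (a * i + b) + d + e = c * a * i + (c * b + d + e) := by ring
          rwa [e1] at this) le_rfl
  have hfd : FiniteDimensional K (G (c * a * i + (c * b + d + e)) • N₀ : Submodule K M) := by
    have f1 : (G (c * a * i + (c * b + d + e))).FG :=
      Module.Finite.iff_fg.1 (hG1.finite _)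
    have f2 : N₀.FG := (Submodule.fg_iff_finiteDimensional N₀).2 hN.1
    have h3 : FiniteDimensional K
        (Submodule.map₂ (Algebra.lsmul K K M : DPn K n →ₐ[K] Module.End K M).toLinearMap
          (G (c * a * i + (c * b + d + e))) N₀ : Submodule K M) :=
      (Submodule.fg_iff_finiteDimensional _).1 (f1.map₂ _ f2)
    exact Submodule.finiteDimensional_of_le (S₂ := Submodule.map₂
        (Algebra.lsmul K K M : DPn K n →ₐ[K] Module.End K M).toLinearMap _ N₀)
      (Submodule.smul_le.2 fun r hr m hm => Submodule.apply_mem_map₂ _ hr hm)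
  exact Submodule.finrank_mono hle

/-- `Dim(M)` can be computed with any filtration of standard type. -/
theorem dimension_eq {F : ℕ → Submodule K (DPn K n)} (hF : IsStandardType F)
    {M₀ : Submodule K M} (hM : IsFiniteGenerating K n M₀) :
    dimension K n M = growthDegree (hilbertFunction F M₀) := by
  refine le_antisymm ?_ ?_
  · exact iInf_le_of_le F (iInf_le_of_le hF (iInf_le_of_le M₀ (iInf_le_of_le hM le_rfl)))
  · refine le_iInf fun G => le_iInf fun hG => le_iInf fun N₀ => le_iInf fun hN => ?_
    obtain ⟨a, b, ha, h⟩ := exists_hilbertFunction_le hF hG hM hN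
    exact growthDegree_le ha h

end Modules

end

/-! Put q = p^k and let D_k be the algebra of operators commuting with all x_j^q. In characteristic
p the bracket with x_j^q is the q-th power of the bracket with x_j (`commutatorRight_pow_char_pow`).
Hence every differential operator lies in D_k for large k, and the bracket with x_j^q lowers ∂^[qβ]
to ∂^[q(β - e_j)]. A Taylor expansion along these brackets writes every operator as a sum of ∂^[qβ]
w_β with w_β in D_k.

The finitely many coefficients of a finite presentation of M lie in one D_k, so right multiplication
by x_j^q descends to endomorphisms ρ_j of M (`exists_level_rightMul`). With M₀ spanned by the
generators, the operators δ_j = ρ_j - x_j^q vanish on D_k M₀ and lower the ∂^[qβ] on their common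
kernel. So the ∂^[qβ] act independently there: a finite dimensional W inside D_k M₀ contributes
(m+1)^n dim W dimensions when β runs over the box [0,m]^n (`pow_mul_finrank_le_hilbertFunction`).

Everything now depends on D_k M₀. Taking W = M₀ gives Dim M ≥ n in all cases. If D_k M₀ is infinite
dimensional, finite generation of D_k provides W of at least linearly growing dimension, so Dim M ≥
n + 1. If it is finite dimensional, the Taylor expansion bounds the Hilbert function by a constant
times (i+2)^n, and M is holonomic. -/

noncomputable section

open Filter

/-! ### Commuting operators and divided power systems -/

section DividedPowerSystem

variable {K ι V : Type*} [Field K] [Fintype ι] [AddCommGroup V] [Module K V]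

/-- The monomial `∏ j, δ j ^ α j` in pairwise commuting operators. -/
def multiPow (δ : ι → Module.End K V) (hδ : Pairwise fun i j => Commute (δ i) (δ j))
    (α : ι →₀ ℕ) : Module.End K V :=
  MonoidHom.noncommPiCoprod (fun j => powersHom (Module.End K V) (δ j))
    (fun _ _ hij _ _ => (hδ hij).pow_pow _ _) fun j => Multiplicative.ofAdd (α j)

variable {δ : ι → Module.End K V} (hδ : Pairwise fun i j => Commute (δ i) (δ j))

theorem multiPow_zero : multiPow δ hδ 0 = 1 :=
  map_one (MonoidHom.noncommPiCoprod (fun j => powersHom (Module.End K V) (δ j)) _)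

theorem multiPow_add (α β : ι →₀ ℕ) :
    multiPow δ hδ (α + β) = multiPow δ hδ α * multiPow δ hδ β :=
  map_mul (MonoidHom.noncommPiCoprod (fun j => powersHom (Module.End K V) (δ j)) _)
    (fun j => Multiplicative.ofAdd (α j)) (fun j => Multiplicative.ofAdd (β j))

theorem multiPow_single [DecidableEq ι] (j : ι) (k : ℕ) : multiPow δ hδ (Finsupp.single j k) = δ j ^ k := by
  have h := MonoidHom.noncommPiCoprod_mulSingle (fun j => powersHom (Module.End K V) (δ j))
    (hcomm := fun _ _ hij _ _ => (hδ hij).pow_pow _ _) j (Multiplicative.ofAdd k)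
  rw [multiPow]
  convert h using 2
  · ext i
    by_cases hi : i = j
    · subst hi; simp
    · simp [hi]
  · simp [powersHom_apply]

theorem multiPow_apply_eq_zero_of_le {α β : ι →₀ ℕ} (h : α ≤ β) {v : V}
    (hv : multiPow δ hδ α v = 0) : multiPow δ hδ β v = 0 := by
  rw [← tsub_add_cancel_of_le h, multiPow_add, Module.End.mul_apply, hv, map_zero]

variable [DecidableEq ι]

/-- A family of operators `E β` is a system of divided powers for the commuting operators `δ j`
if, on the common kernel of the `δ j`, the operator `δ j` lowers the index `β` at `j` by one. -/
structure IsDividedPowerSystem (δ : ι → Module.End K V) (E : (ι →₀ ℕ) → Module.End K V) :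
    Prop where
  commute : Pairwise fun i j => Commute (δ i) (δ j)
  zero : ∀ v, E 0 v = v
  lower : ∀ v, (∀ j, δ j v = 0) → ∀ j β,
    δ j (E β v) = if β j = 0 then 0 else E (β - Finsupp.single j 1) v

namespace IsDividedPowerSystem

variable {E : (ι →₀ ℕ) → Module.End K V} (h : IsDividedPowerSystem δ E)

include h

theorem multiPow_apply {v : V} (hv : ∀ j, δ j v = 0) (α β : ι →₀ ℕ) :
    multiPow δ h.commute α (E β v) = if α ≤ β then E (β - α) v else 0 := by
  induction α using Finsupp.induction_linear generalizing β with
  | zero => simp [multiPow_zero]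
  | add α α' ih ih' =>
    rw [multiPow_add, Module.End.mul_apply, ih' β]
    split_ifs with h1 h2 h2
    · rw [ih, if_pos ((le_tsub_iff_right h1).2 h2), tsub_tsub, add_comm α']
    · rw [ih, if_neg fun h3 => h2 ((le_tsub_iff_right h1).1 h3)]
    · exact absurd (le_add_self.trans h2) h1
    · rw [map_zero]
  | single j k =>
    simp only [multiPow_single, Finsupp.single_le_iff]
    induction k generalizing β with
    | zero => simp
    | succ k ih =>
      rw [pow_succ, Module.End.mul_apply, h.lower v hv]
      split_ifs with h1 h2 h2
      · omega
      · rw [map_zero]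
      · have : (β - Finsupp.single j 1 : ι →₀ ℕ) j = β j - 1 := by simp
        rw [ih, this, if_pos (by omega), tsub_tsub, ← Finsupp.single_add, add_comm 1]
      · have : (β - Finsupp.single j 1 : ι →₀ ℕ) j = β j - 1 := by simp
        rw [ih, this, if_neg (by omega)]

/-- An element that is killed by the monomials in the `δ j` with exponents outside of a finite
lower set `S` is a combination of the divided powers with indices in `S`. -/
theorem exists_eq_sum (S : Finset (ι →₀ ℕ)) (hS : IsLowerSet (S : Set (ι →₀ ℕ))) (v : V)
    (hv : ∀ α, α ∉ S → multiPow δ h.commute α v = 0) :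
    ∃ w : (ι →₀ ℕ) → V, (∀ β j, δ j (w β) = 0) ∧ v = ∑ β ∈ S, E β (w β) := by
  induction hn : S.card generalizing S v with
  | zero =>
    rw [Finset.card_eq_zero] at hn
    subst hn
    refine ⟨0, by simp, ?_⟩
    simpa [multiPow_zero] using hv 0 (by simp)
  | succ m ih =>
    -- The top Taylor coefficient is `u`, the monomial with exponent β applied to `v`. By maximality
    -- β + e_j lies outside `S`, so `u` is killed by every δ_j. Subtracting `E β u` removes β from
    -- `S`.
    obtain ⟨β, hβ⟩ := S.exists_maximal (Finset.card_pos.1 (by omega))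
    have hlt : ∀ α ∈ S, β ≤ α → α = β := fun α hα hle => le_antisymm (hβ.2 hα hle) hle
    set u := multiPow δ h.commute β v with hu
    have hu0 : ∀ j, δ j u = 0 := by
      intro j
      have h1 := hv (Finsupp.single j 1 + β) fun hmem => by
        have := hlt _ hmem le_add_self
        have := DFunLike.congr_fun this j
        simp at this
      rwa [multiPow_add, multiPow_single, pow_one, Module.End.mul_apply] at h1
    have hlow : IsLowerSet ((S.erase β : Finset _) : Set (ι →₀ ℕ)) := by
      intro a b hba ha
      rw [Finset.mem_coe, Finset.mem_erase] at ha ⊢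
      refine ⟨fun hb => ha.1 (hlt a ha.2 (hb ▸ hba)), hS hba ha.2⟩
    obtain ⟨w, hw, hsum⟩ := ih (S.erase β) hlow (v - E β u) (fun α hα => by
      rw [map_sub, h.multiPow_apply hu0]
      by_cases hαβ : α = β
      · subst hαβ
        rw [if_pos le_rfl, tsub_self, h.zero, sub_self]
      · have hαS : α ∉ S := fun h' => hα (Finset.mem_erase.2 ⟨hαβ, h'⟩)
        rw [hv α hαS, if_neg fun hle => hαS (hS hle hβ.1), sub_zero])
      (by rw [Finset.card_erase_of_mem hβ.1, hn, Nat.add_sub_cancel])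
    refine ⟨Function.update w β u, fun γ j => ?_, ?_⟩
    · by_cases hγ : γ = β
      · subst hγ; simp [hu0]
      · simp [hγ, hw]
    · rw [← Finset.add_sum_erase S _ hβ.1, Function.update_self,
        Finset.sum_congr rfl fun γ hγ => by
          rw [Function.update_of_ne (Finset.ne_of_mem_erase hγ)], ← hsum]
      abel

/-- The box version of `exists_eq_sum`. -/
theorem exists_eq_sum_Iic (m : ℕ) (v : V) (hv : ∀ j, (δ j ^ (m + 1)) v = 0) :
    ∃ w : (ι →₀ ℕ) → V, (∀ β j, δ j (w β) = 0) ∧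
      v = ∑ β ∈ Finset.Iic (Finsupp.equivFunOnFinite.symm fun _ : ι => m), E β (w β) := by
  refine h.exists_eq_sum _ (by rw [Finset.coe_Iic]; exact isLowerSet_Iic _) v fun α hα => ?_
  rw [Finset.mem_Iic, Finsupp.le_def, not_forall] at hα
  obtain ⟨j, hj⟩ := hα
  have hj' : m + 1 ≤ α j := by simpa using hj
  refine multiPow_apply_eq_zero_of_le h.commute (Finsupp.single_le_iff.2 hj') ?_
  rw [multiPow_single, hv]

/-- The monomial whose exponent is a maximal index α kills every other term of the sum and returns
`v α`. -/
theorem eq_zero_of_sum_eq_zero (S : Finset (ι →₀ ℕ)) (v : (ι →₀ ℕ) → V)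
    (hv : ∀ β ∈ S, ∀ j, δ j (v β) = 0) (hsum : ∑ β ∈ S, E β (v β) = 0) :
    ∀ β ∈ S, v β = 0 := by
  induction hn : S.card generalizing S with
  | zero =>
    rw [Finset.card_eq_zero] at hn
    subst hn
    simp
  | succ m ih =>
    obtain ⟨α, hα⟩ := S.exists_maximal (Finset.card_pos.1 (by omega))
    have h0 : v α = 0 := by
      have := congrArg (multiPow δ h.commute α) hsum
      rw [map_sum, map_zero, Finset.sum_congr rfl fun β hβ =>
        h.multiPow_apply (hv β hβ) α β, Finset.sum_eq_single α] at this
      · rwa [if_pos le_rfl, tsub_self, h.zero] at this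
      · intro β hβ hne
        exact if_neg fun hle => hne (le_antisymm (hα.2 hβ hle) hle)
      · exact fun h' => absurd hα.1 h'
    rw [← Finset.add_sum_erase S _ hα.1, h0, map_zero, zero_add] at hsum
    intro β hβ
    by_cases hβα : β = α
    · rw [hβα, h0]
    · exact ih (S.erase α) (fun β hβ => hv β (Finset.mem_of_mem_erase hβ)) hsum
        (by rw [Finset.card_erase_of_mem hα.1, hn, Nat.add_sub_cancel]) β
        (Finset.mem_erase.2 ⟨hβα, hβ⟩)

/-- Independence of the divided powers makes the map from `S` copies of `W` to `U` injective. All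
lower bounds for Hilbert functions come from here. -/
theorem card_mul_finrank_le (S : Finset (ι →₀ ℕ)) {W U : Submodule K V}
    [FiniteDimensional K W] [FiniteDimensional K U] (hW : ∀ v ∈ W, ∀ j, δ j v = 0)
    (hU : ∀ β ∈ S, ∀ v ∈ W, E β v ∈ U) :
    S.card * Module.finrank K W ≤ Module.finrank K U := by
  let f : (S → W) →ₗ[K] U := ∑ β : S,
    (((E β).domRestrict W).codRestrict U fun v => hU β β.2 v v.2) ∘ₗ LinearMap.proj β
  have hf : ∀ w : S → W, ((f w : U) : V) = ∑ β : S, E β (w β) := fun w => by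
    simp [f]
    rfl
  have hinj : Function.Injective f := by
    rw [← LinearMap.ker_eq_bot, LinearMap.ker_eq_bot']
    intro w hw
    let v : (ι →₀ ℕ) → V := fun β => if hβ : β ∈ S then w ⟨β, hβ⟩ else 0
    have hvβ : ∀ β : S, v β = w β := fun β => dif_pos β.2
    have hz := h.eq_zero_of_sum_eq_zero S v (fun β hβ j => by
      rw [hvβ ⟨β, hβ⟩]; exact hW _ (w _).2 j) (by
      rw [← Finset.sum_coe_sort]
      simp only [hvβ]
      rw [← hf, hw, ZeroMemClass.coe_zero])
    funext β
    apply Subtype.ext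
    rw [← hvβ, hz β β.2]
    rfl
  have := LinearMap.finrank_le_finrank_of_injective hinj
  rw [Module.finrank_pi_fintype] at this
  simpa using this

end IsDividedPowerSystem

omit [Fintype ι] [DecidableEq ι] in
theorem finrank_le_card_mul {E : (ι →₀ ℕ) → Module.End K V} (S : Finset (ι →₀ ℕ))
    {W U : Submodule K V} [FiniteDimensional K W]
    (hU : ∀ u ∈ U, ∃ w : (ι →₀ ℕ) → V, (∀ β, w β ∈ W) ∧ u = ∑ β ∈ S, E β (w β)) :
    Module.finrank K U ≤ S.card * Module.finrank K W := by
  let f : (S → W) →ₗ[K] V := ∑ β : S, (E β).domRestrict W ∘ₗ LinearMap.proj β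
  have hle : U ≤ LinearMap.range f := by
    intro u hu
    obtain ⟨w, hw, rfl⟩ := hU u hu
    refine ⟨fun β => ⟨w β, hw β⟩, ?_⟩
    rw [← Finset.sum_coe_sort]
    simp [f]
  refine (Submodule.finrank_mono hle).trans ((LinearMap.finrank_range_le f).trans ?_)
  rw [Module.finrank_pi_fintype]
  simp

end DividedPowerSystem

/-! ### Commutators -/

section Commutator

variable (K : Type*) {R : Type*} [Field K] [Ring R] [Algebra K R]

/-- The inner derivation `d ↦ d * y - y * d`. -/
def commutatorRight (y : R) : Module.End K R := LinearMap.mulRight K y - LinearMap.mulLeft K y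

variable {K}

theorem commutatorRight_apply (y d : R) : commutatorRight K y d = d * y - y * d := rfl

/-- Left and right multiplication by `y` commute, so the Frobenius identity (a - b)^q = a^q - b^q
applies to their difference. -/
theorem commutatorRight_pow_char_pow (p k : ℕ) [Fact p.Prime] [CharP K p] [Nontrivial R] (y : R) :
    commutatorRight K y ^ p ^ k = commutatorRight K (y ^ p ^ k) := by
  have : CharP (Module.End K R) p :=
    charP_of_injective_algebraMap (algebraMap K (Module.End K R)).injective p
  rw [commutatorRight, sub_pow_char_pow_of_commute p k
    (LinearMap.commute_mulLeft_right (R := K) y y).symm, LinearMap.pow_mulLeft,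
    LinearMap.pow_mulRight, commutatorRight]

/-- On the kernel of ρ_j - y_j one has ρ_j v = y_j v, hence (ρ_j - y_j)(E_β v) = E_β y_j v - y_j E_β
v: the operator acts as the commutator of E_β with y_j. -/
theorem isDividedPowerSystem_of_commutator {ι V : Type*} [Fintype ι] [DecidableEq ι]
    [AddCommGroup V] [Module K V] [Module R V] [IsScalarTower K R V] {y : ι → R}
    {E : (ι →₀ ℕ) → R} {ρ : ι → Module.End R V} (hy : ∀ i j, Commute (y i) (y j))
    (hρ : ∀ i j, Commute (ρ i) (ρ j)) (h0 : E 0 = 1)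
    (hE : ∀ j β, commutatorRight K (y j) (E β) =
      if β j = 0 then 0 else E (β - Finsupp.single j 1)) :
    IsDividedPowerSystem (K := K) (V := V)
      (fun j => (ρ j).restrictScalars K - Algebra.lsmul K K V (y j))
      (fun β => Algebra.lsmul K K V (E β)) where
  commute i j _ := by
    refine LinearMap.ext fun v => ?_
    have h1 : ρ i (ρ j v) = ρ j (ρ i v) := LinearMap.congr_fun (hρ i j).eq v
    have h2 : y i • y j • v = y j • y i • v := by rw [smul_smul, (hy i j).eq, mul_smul]
    simp only [Module.End.mul_apply, LinearMap.sub_apply, LinearMap.restrictScalars_apply,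
      Algebra.lsmul_coe, map_sub, map_smul, h1, h2]
    abel
  zero v := by simp [h0]
  lower v hv j β := by
    have h1 : ρ j v = y j • v := by simpa [sub_eq_zero] using hv j
    have h2 := hE j β
    rw [commutatorRight_apply] at h2
    have h3 : (E β * y j - y j * E β) • v =
        ((ρ j).restrictScalars K - Algebra.lsmul K K V (y j)) (Algebra.lsmul K K V (E β) v) := by
      simp [sub_smul, mul_smul, h1]
    rw [← h3, h2]
    split_ifs <;> simp

/-- The case of the regular module, with ρ_j the right multiplication by y_j. -/
theorem isDividedPowerSystem_commutatorRight {ι : Type*} [Fintype ι] [DecidableEq ι] {y : ι → R}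
    {E : (ι →₀ ℕ) → R} (hy : ∀ i j, Commute (y i) (y j)) (h0 : E 0 = 1)
    (hE : ∀ j β, commutatorRight K (y j) (E β) =
      if β j = 0 then 0 else E (β - Finsupp.single j 1)) :
    IsDividedPowerSystem (K := K) (V := R)
      (fun j => commutatorRight K (y j)) (fun β => LinearMap.mulLeft K (E β)) :=
  isDividedPowerSystem_of_commutator (ρ := fun j => LinearMap.toSpanSingleton R R (y j)) hy
    (fun i j => LinearMap.ext fun d => by
      simp only [Module.End.mul_apply, LinearMap.toSpanSingleton_apply, smul_eq_mul, mul_assoc,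
        (hy i j).eq]) h0 hE

end Commutator

/-! ### Operators on the polynomial algebra -/

section Operators

variable (K : Type*) [Field K] {n : ℕ}

variable (n) in
/-- Multiplication operators. -/
def polyOp : MvPolynomial (Fin n) K →ₐ[K] DPn K n :=
  (Algebra.lmul K (MvPolynomial (Fin n) K)).codRestrict (diffOp K (MvPolynomial (Fin n) K))
    fun a => ⟨0, mulLeft_mem_diffOpOrder a 0⟩

/-- The divided power operators as elements of `D(P_n)`. -/
def divOp (β : Fin n →₀ ℕ) : DPn K n :=
  ⟨dividedDeriv K n β, _, dividedDeriv_mem_diffOpOrder K _ β le_rfl⟩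

theorem canonicalElement_eq (α β : Fin n →₀ ℕ) :
    canonicalElement K α β = polyOp K n (MvPolynomial.monomial α 1) * divOp K β := rfl

theorem divOp_zero : divOp K (0 : Fin n →₀ ℕ) = 1 := by
  refine Subtype.ext ((MvPolynomial.basisMonomials (Fin n) K).ext fun γ => ?_)
  rw [MvPolynomial.coe_basisMonomials]
  simp [divOp, dividedDeriv_monomial]

theorem divOp_mul (β δ : Fin n →₀ ℕ) : divOp K β * divOp K δ =
    ((∏ i, (β i + δ i).choose (β i) : ℕ) : K) • divOp K (β + δ) := by
  refine Subtype.ext ((MvPolynomial.basisMonomials (Fin n) K).ext fun γ => ?_)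
  rw [MvPolynomial.coe_basisMonomials]
  change dividedDeriv K n β (dividedDeriv K n δ _) = (_ : K) • dividedDeriv K n (β + δ) _
  have h1 : ∀ (ε : Fin n →₀ ℕ) (c : K),
      MvPolynomial.monomial ε c = c • MvPolynomial.monomial ε (1 : K) := fun ε c => by
    rw [MvPolynomial.smul_monomial, smul_eq_mul, mul_one]
  rw [dividedDeriv_monomial, h1, map_smul, dividedDeriv_monomial, dividedDeriv_monomial,
    MvPolynomial.smul_monomial, MvPolynomial.smul_monomial, tsub_tsub, add_comm δ β]
  congr 1
  simp only [smul_eq_mul]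
  rw [← Nat.cast_mul, ← Nat.cast_mul, ← Finset.prod_mul_distrib, ← Finset.prod_mul_distrib]
  congr 1
  refine Finset.prod_congr rfl fun i _ => ?_
  -- Trinomial revision, one coordinate at a time.
  have h2 := Nat.choose_mul (n := γ i) (k := β i + δ i) (s := δ i) (by omega)
  rw [Nat.add_sub_cancel, Nat.choose_symm_add.symm] at h2
  simpa [mul_comm] using h2.symm

theorem commutatorRight_divOp (j : Fin n) (β : Fin n →₀ ℕ) :
    commutatorRight K (polyOp K n (MvPolynomial.X j)) (divOp K β) =
      if β j = 0 then 0 else divOp K (β - Finsupp.single j 1) := by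
  refine Subtype.ext ((dividedDeriv_comm_X K β j).trans ?_)
  split_ifs <;> rfl

theorem commutatorRight_pow_divOp (j : Fin n) (r : ℕ) (β : Fin n →₀ ℕ) :
    (commutatorRight K (polyOp K n (MvPolynomial.X j)) ^ r) (divOp K β) =
      if r ≤ β j then divOp K (β - Finsupp.single j r) else 0 := by
  induction r generalizing β with
  | zero => simp
  | succ r ih =>
    rw [pow_succ, Module.End.mul_apply, commutatorRight_divOp]
    have : (β - Finsupp.single j 1 : Fin n →₀ ℕ) j = β j - 1 := by simp
    split_ifs with h1 h2 h2
    · omega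
    · rw [map_zero]
    · rw [ih, this, if_pos (by omega), tsub_tsub, ← Finsupp.single_add, add_comm 1]
    · rw [ih, this, if_neg (by omega)]

variable {K} in
-- Each bracket lowers the order by one, and order 0 needs one more bracket to vanish.
theorem commutatorRight_pow_eq_zero {m : ℕ} {d : DPn K n}
    (hd : d.1 ∈ diffOpOrder K _ m) (a : MvPolynomial (Fin n) K) :
    (commutatorRight K (polyOp K n a) ^ (m + 1)) d = 0 := by
  induction m generalizing d with
  | zero =>
    rw [zero_add, pow_one]
    exact Subtype.ext (mem_diffOpOrder_zero.1 hd a)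
  | succ m ih =>
    rw [pow_succ, Module.End.mul_apply]
    exact ih (mem_diffOpOrder_succ.1 hd a)

/-! ### Frobenius powers of the variables and the operators of level `k` -/

section CharP

variable (p k : ℕ)

variable (n) in
/-- The powers `x_j ^ (p ^ k)` of the variables. -/
def frobX (j : Fin n) : DPn K n := polyOp K n (MvPolynomial.X j) ^ p ^ k

theorem frobX_eq_polyOp (j : Fin n) :
    frobX K n p k j = polyOp K n (MvPolynomial.X j ^ p ^ k) := (map_pow _ _ _).symm

variable (n) in
/-- The differential operators that are linear over the polynomials in the `x_j ^ (p ^ k)`. -/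
def levelOp : Subalgebra K (DPn K n) := Subalgebra.centralizer K (Set.range (frobX K n p k))

variable {K p k} in
theorem mem_levelOp {d : DPn K n} :
    d ∈ levelOp K n p k ↔ ∀ j, commutatorRight K (frobX K n p k j) d = 0 := by
  simp only [levelOp, Subalgebra.mem_centralizer_iff, Set.forall_mem_range,
    commutatorRight_apply, sub_eq_zero]
  exact forall_congr' fun j => eq_comm

theorem frobX_commute (i j : Fin n) : Commute (frobX K n p k i) (frobX K n p k j) := by
  rw [frobX_eq_polyOp, frobX_eq_polyOp]
  exact (Commute.all _ _).map (polyOp K n)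

variable {K p} in
-- For `k = 0` the operator commutes with the variables themselves, so it is multiplication by its
-- value at 1.
theorem levelOp_zero_le : levelOp K n p 0 ≤ (polyOp K n).range := by
  intro d hd
  have hX : ∀ j, d * polyOp K n (MvPolynomial.X j) = polyOp K n (MvPolynomial.X j) * d := fun j => by
    have := mem_levelOp.1 hd j
    rwa [frobX, pow_zero, pow_one, commutatorRight_apply, sub_eq_zero] at this
  have hX' : ∀ j a, d.1 (MvPolynomial.X j * a) = MvPolynomial.X j * d.1 a := fun j a =>
    LinearMap.congr_fun (congrArg Subtype.val (hX j)) a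
  refine ⟨d.1 1, Subtype.ext (LinearMap.ext fun a => ?_)⟩
  change d.1 1 * a = d.1 a
  induction a using MvPolynomial.induction_on with
  | C c =>
    rw [mul_comm, ← mul_one (MvPolynomial.C c), ← MvPolynomial.smul_eq_C_mul, map_smul,
      smul_mul_assoc, MvPolynomial.smul_eq_C_mul, MvPolynomial.smul_eq_C_mul, one_mul]
  | add a b ha hb => rw [mul_add, ha, hb, map_add]
  | mul_X a j ha => rw [mul_comm a, hX', ← ha, mul_left_comm]

variable [Fact p.Prime] [CharP K p]

theorem commutatorRight_frobX (j : Fin n) : commutatorRight K (frobX K n p k j) =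
    commutatorRight K (polyOp K n (MvPolynomial.X j)) ^ p ^ k :=
  (commutatorRight_pow_char_pow p k _).symm

/-- The bracket with x_j is applied p^k times and so subtracts p^k from the j-th index; on multiples
of p^k this is a shift by one. -/
theorem commutatorRight_frobX_divOp (j : Fin n) (β : Fin n →₀ ℕ) :
    commutatorRight K (frobX K n p k j) (divOp K (p ^ k • β)) =
      if β j = 0 then 0 else divOp K (p ^ k • (β - Finsupp.single j 1)) := by
  have hq : 0 < p ^ k := pow_pos (Fact.out : p.Prime).pos k
  have hqβ : (p ^ k • β) j = p ^ k * β j := by simp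
  rw [commutatorRight_frobX, commutatorRight_pow_divOp, hqβ]
  split_ifs with h1 h2 h2
  · rw [h2] at h1; omega
  · congr 1
    ext i
    by_cases hi : j = i
    · subst hi; simp [Nat.mul_sub]
    · simp [hi]
  · rfl
  · exact absurd (Nat.le_mul_of_pos_right _ (Nat.pos_of_ne_zero h2)) h1

variable {K p k} in
-- The bracket with x_j^(p^k) is a p^k-fold bracket with x_j, and m + 1 ≤ p^k of them already kill
-- an operator of order m. Hence the levels exhaust the ring.
theorem mem_levelOp_of_lt {m : ℕ} {d : DPn K n}
    (hd : d.1 ∈ diffOpOrder K _ m) (hm : m < p ^ k) : d ∈ levelOp K n p k := by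
  refine mem_levelOp.2 fun j => ?_
  rw [commutatorRight_frobX, ← Nat.sub_add_cancel (Nat.succ_le_of_lt hm), pow_add,
    Module.End.mul_apply, Nat.succ_eq_add_one, commutatorRight_pow_eq_zero hd, map_zero]

theorem polyOp_mem_levelOp (a : MvPolynomial (Fin n) K) : polyOp K n a ∈ levelOp K n p k :=
  mem_levelOp_of_lt (mulLeft_mem_diffOpOrder a 0) (pow_pos (Fact.out : p.Prime).pos k)

theorem divOp_mem_levelOp {β : Fin n →₀ ℕ} (hβ : ∀ j, β j < p ^ k) :
    divOp K β ∈ levelOp K n p k := by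
  refine mem_levelOp.2 fun j => ?_
  rw [commutatorRight_frobX, commutatorRight_pow_divOp, if_neg (not_le.2 (hβ j))]

/-- Every module with commuting endomorphisms that play the role of a right multiplication by the
`x_j ^ (p ^ k)` carries a divided power system. -/
theorem isDividedPowerSystem_divOp {V : Type*} [AddCommGroup V] [Module K V] [Module (DPn K n) V]
    [IsScalarTower K (DPn K n) V] {ρ : Fin n → Module.End (DPn K n) V}
    (hρ : ∀ i j, Commute (ρ i) (ρ j)) :
    IsDividedPowerSystem (K := K) (V := V)
      (fun j => (ρ j).restrictScalars K - Algebra.lsmul K K V (frobX K n p k j))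
      (fun β => Algebra.lsmul K K V (divOp K (p ^ k • β))) :=
  isDividedPowerSystem_of_commutator (E := fun β => divOp K (p ^ k • β)) (frobX_commute K p k) hρ
    (by simp [divOp_zero]) (commutatorRight_frobX_divOp K p k)

/-- The constant exponent `(m, …, m)`. -/
abbrev constExp (n m : ℕ) : Fin n →₀ ℕ := Finsupp.equivFunOnFinite.symm fun _ : Fin n => m

/-- Expansion of a differential operator in the divided powers `∂^[p^k β]`. -/
theorem exists_eq_sum_divOp_mul (m : ℕ) (d : DPn K n)
    (hd : ∀ j, (commutatorRight K (frobX K n p k j) ^ (m + 1)) d = 0) :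
    ∃ w : (Fin n →₀ ℕ) → DPn K n, (∀ β, w β ∈ levelOp K n p k) ∧
      d = ∑ β ∈ Finset.Iic (constExp n m), divOp K (p ^ k • β) * w β := by
  have h := isDividedPowerSystem_commutatorRight (K := K) (E := fun β : Fin n →₀ ℕ => divOp K (p ^ k • β))
    (frobX_commute K p k) (by simp [divOp_zero]) (commutatorRight_frobX_divOp K p k)
  obtain ⟨w, hw, hsum⟩ := h.exists_eq_sum_Iic m d hd
  exact ⟨w, fun β => mem_levelOp.2 (hw β), hsum⟩

theorem exists_eq_sum_divOp_mul_of_mem {m : ℕ} {d : DPn K n}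
    (hd : d.1 ∈ diffOpOrder K _ m) :
    ∃ w : (Fin n →₀ ℕ) → DPn K n, (∀ β, w β ∈ levelOp K n p k) ∧
      d = ∑ β ∈ Finset.Iic (constExp n m), divOp K (p ^ k • β) * w β := by
  refine exists_eq_sum_divOp_mul K p k m d fun j => ?_
  rw [frobX_eq_polyOp]
  exact commutatorRight_pow_eq_zero hd _

end CharP

/-- The Taylor expansion at level 0, where the coefficients are polynomials. -/
theorem exists_eq_sum_divOp_mul_polyOp (p : ℕ) [Fact p.Prime] [CharP K p]
    (m : ℕ) (d : DPn K n)
    (hd : ∀ j, (commutatorRight K (polyOp K n (MvPolynomial.X j)) ^ (m + 1)) d = 0) :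
    ∃ w : (Fin n →₀ ℕ) → MvPolynomial (Fin n) K,
      d = ∑ β ∈ Finset.Iic (constExp n m), divOp K β * polyOp K n (w β) := by
  obtain ⟨w, hw, hsum⟩ := exists_eq_sum_divOp_mul K p 0 m d (by simpa [frobX] using hd)
  choose u hu using fun β => levelOp_zero_le (hw β)
  refine ⟨u, hsum.trans (Finset.sum_congr rfl fun β _ => ?_)⟩
  rw [pow_zero, one_smul, ← hu β]
  rfl

end Operators

/-! ### The canonical filtration is of standard type -/

section CanonicalFiltration

variable {K : Type*} [Field K] {n : ℕ}

theorem canonicalElement_mem {α β : Fin n →₀ ℕ} {i : ℕ} (h : α.degree + β.degree ≤ i) :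
    canonicalElement K α β ∈ canonicalFiltration K n i :=
  Submodule.subset_span ⟨α, β, h, rfl⟩

theorem canonicalFiltration_mono : Monotone (canonicalFiltration K n) := fun _ _ hij =>
  Submodule.span_mono fun _ ⟨α, β, h, e⟩ => ⟨α, β, h.trans hij, e⟩

theorem divOp_mem_canonicalFiltration {β : Fin n →₀ ℕ} {i : ℕ} (h : β.degree ≤ i) :
    divOp K β ∈ canonicalFiltration K n i := by
  have := canonicalElement_mem (K := K) (α := 0) (β := β) (i := i) (by simpa using h)
  rwa [canonicalElement_eq, ← MvPolynomial.one_def, map_one, one_mul] at this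

/-- Moving x_j to the left past ∂^[β] costs only the term ∂^[β - e_j], of smaller degree. -/
theorem mul_X_mem_canonicalFiltration {d : DPn K n} {i : ℕ} (hd : d ∈ canonicalFiltration K n i)
    (j : Fin n) : d * polyOp K n (MvPolynomial.X j) ∈ canonicalFiltration K n (i + 1) := by
  induction hd using Submodule.span_induction with
  | mem d hd =>
    obtain ⟨α, β, h, rfl⟩ := hd
    have hc := commutatorRight_divOp K j β
    rw [commutatorRight_apply, sub_eq_iff_eq_add] at hc
    rw [canonicalElement_eq, mul_assoc, hc, mul_add, ← mul_assoc, ← map_mul, MvPolynomial.X,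
      MvPolynomial.monomial_mul, one_mul, ← canonicalElement_eq]
    refine add_mem ?_ (canonicalElement_mem ?_)
    · split_ifs with h0
      · rw [mul_zero]; exact zero_mem _
      · rw [← canonicalElement_eq]
        have hle := Finsupp.degree_mono (tsub_le_self : β - Finsupp.single j 1 ≤ β)
        exact canonicalElement_mem (by omega)
    · rw [map_add, Finsupp.degree_single]; omega
  | zero => rw [zero_mul]; exact zero_mem _
  | add a b _ _ ha hb => rw [add_mul]; exact add_mem ha hb
  | smul c a _ ha => rw [smul_mul_assoc]; exact Submodule.smul_mem _ c ha

theorem mul_monomial_mem_canonicalFiltration {d : DPn K n} {i : ℕ}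
    (hd : d ∈ canonicalFiltration K n i) (γ : Fin n →₀ ℕ) :
    d * polyOp K n (MvPolynomial.monomial γ 1) ∈ canonicalFiltration K n (i + γ.degree) := by
  induction γ using Finsupp.induction_linear generalizing d i with
  | zero => simpa [← MvPolynomial.one_def] using hd
  | add γ γ' ih ih' =>
    have : MvPolynomial.monomial (γ + γ') (1 : K) =
        MvPolynomial.monomial γ 1 * MvPolynomial.monomial γ' 1 := by
      rw [MvPolynomial.monomial_mul, one_mul]
    rw [this, map_mul, ← mul_assoc, map_add, ← add_assoc]
    exact ih' (ih hd)
  | single j k =>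
    rw [Finsupp.degree_single, ← MvPolynomial.X_pow_eq_monomial]
    induction k with
    | zero => simpa using hd
    | succ k ih =>
      rw [pow_succ, map_mul, ← mul_assoc, ← add_assoc]
      exact mul_X_mem_canonicalFiltration ih j

theorem mul_divOp_mem_canonicalFiltration {d : DPn K n} {i : ℕ}
    (hd : d ∈ canonicalFiltration K n i) (γ : Fin n →₀ ℕ) :
    d * divOp K γ ∈ canonicalFiltration K n (i + γ.degree) := by
  induction hd using Submodule.span_induction with
  | mem d hd =>
    obtain ⟨α, β, h, rfl⟩ := hd
    rw [canonicalElement_eq, mul_assoc, divOp_mul, mul_smul_comm, ← canonicalElement_eq]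
    refine Submodule.smul_mem _ _ (canonicalElement_mem ?_)
    rw [map_add]; omega
  | zero => rw [zero_mul]; exact zero_mem _
  | add a b _ _ ha hb => rw [add_mul]; exact add_mem ha hb
  | smul c a _ ha => rw [smul_mul_assoc]; exact Submodule.smul_mem _ c ha

theorem mul_mem_canonicalFiltration {i j : ℕ} {d e : DPn K n}
    (hd : d ∈ canonicalFiltration K n i) (he : e ∈ canonicalFiltration K n j) :
    d * e ∈ canonicalFiltration K n (i + j) := by
  induction he using Submodule.span_induction with
  | mem e he =>
    obtain ⟨α, β, h, rfl⟩ := he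
    rw [canonicalElement_eq, ← mul_assoc]
    exact canonicalFiltration_mono (by omega)
      (mul_divOp_mem_canonicalFiltration (mul_monomial_mem_canonicalFiltration hd α) β)
  | zero => rw [mul_zero]; exact zero_mem _
  | add a b _ _ ha hb => rw [mul_add]; exact add_mem ha hb
  | smul c a _ ha => rw [mul_smul_comm]; exact Submodule.smul_mem _ c ha

theorem canonicalFiltration_mul_le (i j : ℕ) :
    canonicalFiltration K n i * canonicalFiltration K n j ≤ canonicalFiltration K n (i + j) :=
  Submodule.mul_le.2 fun _ hd _ he => mul_mem_canonicalFiltration hd he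

theorem one_mem_canonicalFiltration : (1 : DPn K n) ∈ canonicalFiltration K n 0 := by
  rw [← divOp_zero]
  exact divOp_mem_canonicalFiltration (by simp)

theorem exists_polyOp_mem_canonicalFiltration (a : MvPolynomial (Fin n) K) :
    ∃ i, polyOp K n a ∈ canonicalFiltration K n i := by
  induction a using MvPolynomial.induction_on with
  | C c =>
    refine ⟨0, ?_⟩
    rw [← MvPolynomial.algebraMap_eq, AlgHom.commutes, Algebra.algebraMap_eq_smul_one]
    exact Submodule.smul_mem _ c one_mem_canonicalFiltration
  | add a b ha hb =>
    obtain ⟨i, hi⟩ := ha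
    obtain ⟨j, hj⟩ := hb
    rw [map_add]
    exact ⟨i + j, add_mem (canonicalFiltration_mono (Nat.le_add_right i j) hi)
      (canonicalFiltration_mono (Nat.le_add_left j i) hj)⟩
  | mul_X a j ha =>
    obtain ⟨i, hi⟩ := ha
    rw [map_mul]
    exact ⟨i + 1, mul_X_mem_canonicalFiltration hi j⟩

/-- The level 0 expansion has finitely many terms, and each factor ∂^[β] or polynomial lies in some
step of the filtration. -/
theorem exists_mem_canonicalFiltration (p : ℕ) [Fact p.Prime] [CharP K p] (d : DPn K n) :
    ∃ i, d ∈ canonicalFiltration K n i := by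
  obtain ⟨m, hm⟩ := d.2
  obtain ⟨w, hw⟩ := exists_eq_sum_divOp_mul_polyOp K p m d fun j =>
    commutatorRight_pow_eq_zero hm _
  choose l hl using fun β => exists_polyOp_mem_canonicalFiltration (w β)
  refine ⟨(Finset.Iic (constExp n m)).sup fun β => β.degree + l β, ?_⟩
  rw [hw]
  refine sum_mem fun β hβ => canonicalFiltration_mono
    (Finset.le_sup (f := fun β : Fin n →₀ ℕ => β.degree + l β) hβ) ?_
  exact mul_mem_canonicalFiltration (divOp_mem_canonicalFiltration le_rfl) (hl β)

theorem finite_canonicalFiltration (i : ℕ) :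
    Module.Finite K (canonicalFiltration K n i) := by
  have hfin : ∀ α : Fin n →₀ ℕ, α.degree ≤ i → α ∈ Set.Iic (constExp n i) := fun α hα =>
    Finsupp.le_def.2 fun j => (Finsupp.le_degree j α).trans hα
  refine Module.Finite.span_of_finite K
    (((Set.finite_Iic (constExp n i)).image2 (canonicalElement K)
      (Set.finite_Iic (constExp n i))).subset ?_)
  rintro d ⟨α, β, h, rfl⟩
  exact ⟨α, hfin α (by omega), β, hfin β (by omega), rfl⟩

theorem isStandardType_canonicalFiltration (p : ℕ) [Fact p.Prime] [CharP K p] :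
    IsStandardType (canonicalFiltration K n) :=
  ⟨⟨canonicalFiltration_mono, exists_mem_canonicalFiltration p, one_mem_canonicalFiltration,
    fun _ _ _ _ => mul_mem_canonicalFiltration, finite_canonicalFiltration⟩,
    1, 0, 1, 0, one_pos, one_pos, by simp, by simp⟩

/-- The bound is one above the sharp order `i`, which does not affect the growth. -/
theorem mem_diffOpOrder_of_mem_canonicalFiltration {i : ℕ} {d : DPn K n}
    (hd : d ∈ canonicalFiltration K n i) : d.1 ∈ diffOpOrder K _ (i + 1) := by
  induction hd using Submodule.span_induction with
  | mem d hd =>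
    obtain ⟨α, β, h, rfl⟩ := hd
    have := mul_mem_diffOpOrder 0 (i + 1)
      (mulLeft_mem_diffOpOrder (MvPolynomial.monomial α (1 : K)) 0)
      (dividedDeriv_mem_diffOpOrder K i β (by omega))
    rwa [zero_add] at this
  | zero => exact zero_mem _
  | add a b _ _ ha hb => exact add_mem ha hb
  | smul c a _ ha => exact Submodule.smul_mem _ c ha

end CanonicalFiltration

/-! ### Finite generation of the rings of operators of bounded level -/

section LevelGenerators

variable (K : Type*) [Field K] (n p k : ℕ)

/-- Generators of the algebra of operators of level `k`. -/
def levelGenerators : Set (DPn K n) :=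
  Set.range (fun j => polyOp K n (MvPolynomial.X j)) ∪
    divOp K '' Set.Iic (constExp n (p ^ k - 1))

theorem finite_levelGenerators : (levelGenerators K n p k).Finite :=
  (Set.finite_range _).union ((Set.finite_Iic _).image _)

theorem polyOp_mem_adjoin_levelGenerators (a : MvPolynomial (Fin n) K) :
    polyOp K n a ∈ Algebra.adjoin K (levelGenerators K n p k) := by
  induction a using MvPolynomial.induction_on with
  | C c =>
    rw [← MvPolynomial.algebraMap_eq, AlgHom.commutes]
    exact Subalgebra.algebraMap_mem _ c
  | add a b ha hb => rw [map_add]; exact add_mem ha hb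
  | mul_X a j ha =>
    rw [map_mul]
    exact mul_mem ha (Algebra.subset_adjoin (Or.inl ⟨j, rfl⟩))

variable [Fact p.Prime] [CharP K p]

theorem levelGenerators_subset : levelGenerators K n p k ⊆ levelOp K n p k := by
  have hq : 0 < p ^ k := pow_pos (Fact.out : p.Prime).pos k
  rintro _ (⟨j, rfl⟩ | ⟨β, hβ, rfl⟩)
  · exact polyOp_mem_levelOp K p k _
  · refine divOp_mem_levelOp K p k fun j => ?_
    have : β j ≤ p ^ k - 1 := Finsupp.le_def.1 hβ j
    omega

/-- An operator of level `k` is killed by p^k brackets with each x_j, so its level 0 expansion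
involves only ∂^[β] with all β_j ≤ p^k - 1. -/
theorem levelOp_le_adjoin : levelOp K n p k ≤ Algebra.adjoin K (levelGenerators K n p k) := by
  have hq : 0 < p ^ k := pow_pos (Fact.out : p.Prime).pos k
  intro d hd
  obtain ⟨w, hw⟩ := exists_eq_sum_divOp_mul_polyOp K p (p ^ k - 1) d fun j => by
    rw [Nat.sub_add_cancel hq, ← commutatorRight_frobX]
    exact mem_levelOp.1 hd j
  rw [hw]
  refine sum_mem fun β hβ => mul_mem (Algebra.subset_adjoin (Or.inr ⟨β, ?_, rfl⟩))
    (polyOp_mem_adjoin_levelGenerators K n p k _)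
  exact Finset.mem_Iic.1 hβ

end LevelGenerators

theorem card_Iic_constExp (n m : ℕ) : (Finset.Iic (constExp n m)).card = (m + 1) ^ n := by
  rw [Finsupp.card_Iic, Finset.prod_subset (Finset.subset_univ _)]
  · simp
  · intro i _ hi
    rw [Finsupp.notMem_support_iff] at hi
    rw [hi]
    rfl

/-! ### Growth of polynomials -/

section Growth

theorem le_growthDegree {f : ℕ → ℕ} {e : ℕ} (h : ∀ᶠ i in atTop, i ^ e ≤ f i) :
    (e : EReal) ≤ growthDegree f := by
  refine le_iInf fun r => le_iInf fun hr => ?_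
  obtain ⟨i, h1, h2, h3⟩ := (h.and (hr.and (eventually_ge_atTop 2))).exists
  have hi : (1 : ℝ) < i := by exact_mod_cast h3
  have h4 : (i : ℝ) ^ (e : ℝ) ≤ (i : ℝ) ^ r := by
    rw [Real.rpow_natCast]
    exact le_trans (by exact_mod_cast h1) h2
  have h5 : (e : ℝ) ≤ r := (Real.rpow_le_rpow_left_iff hi).1 h4
  exact_mod_cast EReal.coe_le_coe_iff.2 h5

theorem growthDegree_le_natDegree {f : ℕ → ℕ} (q : Polynomial ℚ)
    (h : ∀ᶠ i : ℕ in atTop, (f i : ℚ) ≤ q.eval (i : ℚ)) :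
    growthDegree f ≤ (q.natDegree : EReal) := by
  have hO : (fun x : ℝ => (q.map (algebraMap ℚ ℝ)).eval x) =O[atTop]
      fun x : ℝ => (Polynomial.X ^ q.natDegree : Polynomial ℝ).eval x := by
    refine Polynomial.isBigO_atTop_of_degree_le _ _ ?_
    rw [Polynomial.degree_X_pow]
    exact (Polynomial.degree_map_le).trans Polynomial.degree_le_natDegree
  obtain ⟨c, hc⟩ := (hO.comp_tendsto tendsto_natCast_atTop_atTop).bound
  have key : ∀ ε : ℝ, 0 < ε → growthDegree f ≤ ((q.natDegree + ε : ℝ) : EReal) := by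
    intro ε hε
    -- The extra exponent ε absorbs the constant `c` of the asymptotic bound; it is then let tend to
    -- 0.
    refine iInf_le_of_le (q.natDegree + ε) (iInf_le_of_le ?_ le_rfl)
    have hε' : Tendsto (fun i : ℕ => (i : ℝ) ^ ε) atTop atTop :=
      (tendsto_rpow_atTop hε).comp tendsto_natCast_atTop_atTop
    filter_upwards [h, hc, eventually_ge_atTop 1, hε'.eventually_ge_atTop c] with i h1 h2 h3 h4
    have hi : (0 : ℝ) < i := by exact_mod_cast h3
    have h5 : (f i : ℝ) ≤ (q.map (algebraMap ℚ ℝ)).eval (i : ℝ) := by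
      rw [Polynomial.eval_natCast_map]
      simpa using (Rat.cast_le (K := ℝ)).2 h1
    simp only [Function.comp_apply, Real.norm_eq_abs, Polynomial.eval_pow, Polynomial.eval_X,
      abs_pow, Nat.abs_cast] at h2
    rw [Real.rpow_add hi, Real.rpow_natCast, mul_comm]
    exact h5.trans ((le_abs_self _).trans (h2.trans
      (mul_le_mul_of_nonneg_right h4 (by positivity))))
  refine EReal.le_of_forall_lt_iff_le.1 fun z hz => ?_
  have hz' : (q.natDegree : ℝ) < z := by exact_mod_cast hz
  simpa using key (z - q.natDegree) (by linarith)

end Growth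

/-! ### Subspaces generated by subspaces of an algebra -/

section SmulSubspace

variable {K R M : Type*} [Field K] [Semiring R] [Algebra K R] [AddCommGroup M] [Module K M]
  [Module R M] [IsScalarTower K R M]

theorem finiteDimensional_smul {F : Submodule K R} {M₀ : Submodule K M} (hF : Module.Finite K F)
    (hM : FiniteDimensional K M₀) : FiniteDimensional K (F • M₀ : Submodule K M) := by
  have h3 : FiniteDimensional K
      (Submodule.map₂ (Algebra.lsmul K K M : R →ₐ[K] Module.End K M).toLinearMap F M₀ :
        Submodule K M) :=
    (Submodule.fg_iff_finiteDimensional _).1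
      ((Module.Finite.iff_fg.1 hF).map₂ _ ((Submodule.fg_iff_finiteDimensional M₀).2 hM))
  exact Submodule.finiteDimensional_of_le (S₂ := Submodule.map₂
      (Algebra.lsmul K K M : R →ₐ[K] Module.End K M).toLinearMap F M₀)
    (Submodule.smul_le.2 fun r hr m hm => Submodule.apply_mem_map₂ _ hr hm)

theorem le_smul_of_one_mem {F : Submodule K R} (h : 1 ∈ F) (M₀ : Submodule K M) : M₀ ≤ F • M₀ :=
  fun x hx => by simpa using Submodule.smul_mem_smul h hx

theorem smul_mem_smul_of_mul_le {F G H : Submodule K R} {M₀ : Submodule K M}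
    (h : F * G ≤ H) {a : R} (ha : a ∈ F) {x : M} (hx : x ∈ G • M₀) :
    a • x ∈ H • M₀ := by
  have h1 : a • x ∈ F • (G • M₀) := Submodule.smul_mem_smul ha hx
  rw [← Submodule.smul_assoc, smul_eq_mul] at h1
  exact Submodule.smul_mono h le_rfl h1

theorem pow_le_toSubmodule {A : Subalgebra K R} {B : Submodule K R}
    (h : B ≤ Subalgebra.toSubmodule A) (i : ℕ) : B ^ i ≤ Subalgebra.toSubmodule A := by
  induction i with
  | zero => rw [pow_zero, Submodule.one_le]; exact one_mem A
  | succ i ih => rw [pow_succ]; exact Submodule.mul_le.2 fun a ha b hb => A.mul_mem (ih ha) (h hb)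

theorem pow_le_of_mul_le {F : ℕ → Submodule K R} (h1 : 1 ∈ F 0)
    (hmul : ∀ i j, F i * F j ≤ F (i + j))
    {B : Submodule K R} {l : ℕ} (h : B ≤ F l) (i : ℕ) : B ^ i ≤ F (l * i) := by
  induction i with
  | zero => rw [pow_zero, Submodule.one_le]; exact h1
  | succ i ih => rw [pow_succ]; exact (mul_le_mul' ih h).trans (hmul _ _)

theorem exists_span_le {F : ℕ → Submodule K R} (hmono : Monotone F) (h : ∀ a, ∃ i, a ∈ F i)
    {G : Set R} (hG : G.Finite) : ∃ l, Submodule.span K G ≤ F l := by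
  choose o ho using h
  obtain ⟨S, rfl⟩ := hG.exists_finset_coe
  exact ⟨S.sup o, Submodule.span_le.2 fun x hx => hmono (Finset.le_sup (f := o) hx) (ho x)⟩

/-- If a finitely generated algebra `A` of operators generates an infinite dimensional space from
`M₀`, then the spaces `B ^ i • M₀`, with `B` spanned by the generators, grow at least linearly. -/
theorem le_finrank_pow_smul {G : Set R} {B : Submodule K R} (hG : G ⊆ B) (h1 : 1 ∈ B)
    (hB : Module.Finite K B) {M₀ : Submodule K M} (hM : FiniteDimensional K M₀) {A : Submodule K R}
    (hA : A ≤ Subalgebra.toSubmodule (Algebra.adjoin K G))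
    (hinf : ¬ FiniteDimensional K (A • M₀ : Submodule K M)) (i : ℕ) :
    i ≤ Module.finrank K (B ^ i • M₀ : Submodule K M) := by
  have hfd : ∀ i, FiniteDimensional K (B ^ i • M₀ : Submodule K M) := fun i =>
    finiteDimensional_smul (Module.Finite.iff_fg.2 ((Module.Finite.iff_fg.1 hB).pow i)) hM
  induction i with
  | zero => exact Nat.zero_le _
  | succ i ih =>
    have hsucc : (B ^ (i + 1) • M₀ : Submodule K M) = B • (B ^ i • M₀) := by
      rw [pow_succ', ← smul_eq_mul, Submodule.smul_assoc]
    have hle : (B ^ i • M₀ : Submodule K M) ≤ B ^ (i + 1) • M₀ := by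
      rw [hsucc]
      intro x hx
      simpa using Submodule.smul_mem_smul h1 hx
    have hM₀ : M₀ ≤ B ^ i • M₀ := fun x hx => by
      simpa using Submodule.smul_mem_smul (show (1 : R) ∈ B ^ i by
        simpa using Submodule.pow_mem_pow B h1 i) hx
    -- If the chain stopped at step `i`, then B^i M₀ would be stable under the generators, hence
    -- contain all of A M₀, which is infinite dimensional.
    have hne : (B ^ i • M₀ : Submodule K M) ≠ B ^ (i + 1) • M₀ := by
      intro heq
      refine hinf (Submodule.finiteDimensional_of_le (S₂ := B ^ i • M₀)
        (Submodule.smul_le.2 fun r hr m hm => ?_))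
      have key : ∀ r ∈ Algebra.adjoin K G, ∀ x ∈ (B ^ i • M₀ : Submodule K M),
          r • x ∈ (B ^ i • M₀ : Submodule K M) := by
        intro r hr
        induction hr using Algebra.adjoin_induction with
        | mem r hr =>
          intro x hx
          rw [heq, hsucc]
          exact Submodule.smul_mem_smul (hG hr) hx
        | algebraMap c =>
          intro x hx
          rw [algebraMap_smul]
          exact Submodule.smul_mem _ c hx
        | add a b _ _ ha hb => intro x hx; rw [add_smul]; exact add_mem (ha x hx) (hb x hx)
        | mul a b _ _ ha hb => intro x hx; rw [mul_smul]; exact ha _ (hb x hx)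
      exact key r (hA hr) m (hM₀ hm)
    exact Nat.succ_le_of_lt (ih.trans_lt (Submodule.finrank_lt_finrank_of_lt
      (lt_of_le_of_ne hle hne)))

/-- The finitely many generators lie in a single `F l`, so the i-th power of their span lies in `F
(l * i)`: linear growth of the dimension is seen at linear cost in the filtration. -/
theorem exists_le_finrank_of_not_finiteDimensional {F : ℕ → Submodule K R} (hmono : Monotone F)
    (hex : ∀ a, ∃ i, a ∈ F i) (hF1 : 1 ∈ F 0) (hmul : ∀ i j, F i * F j ≤ F (i + j))
    {A : Subalgebra K R} {G : Set R} (hG : G.Finite) (hGA : G ⊆ A) (hA : A ≤ Algebra.adjoin K G)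
    {M₀ : Submodule K M} (hM : FiniteDimensional K M₀)
    (hinf : ¬ FiniteDimensional K (Subalgebra.toSubmodule A • M₀ : Submodule K M)) :
    ∃ l, ∀ i, ∃ W : Submodule K M, FiniteDimensional K W ∧ W ≤ Subalgebra.toSubmodule A • M₀ ∧
      W ≤ F (l * i) • M₀ ∧ i ≤ Module.finrank K W := by
  set B : Submodule K R := Submodule.span K (insert 1 G)
  have hB : Module.Finite K B := Module.Finite.span_of_finite K (hG.insert 1)
  obtain ⟨l, hl⟩ := exists_span_le hmono hex (hG.insert 1)
  exact ⟨l, fun i => ⟨B ^ i • M₀,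
    finiteDimensional_smul (Module.Finite.iff_fg.2 ((Module.Finite.iff_fg.1 hB).pow i)) hM,
    Submodule.smul_mono (pow_le_toSubmodule
      (Submodule.span_le.2 (Set.insert_subset A.one_mem hGA)) i) le_rfl,
    Submodule.smul_mono (pow_le_of_mul_le hF1 hmul hl i) le_rfl,
    le_finrank_pow_smul (fun x hx => Submodule.subset_span (Set.mem_insert_of_mem _ hx))
      (Submodule.subset_span (Set.mem_insert _ _)) hB hM hA hinf i⟩⟩

end SmulSubspace

/-! ### Right multiplications on finitely presented modules -/

section Presentation

/-- A map given on generators extends to a module if it kills the relations. -/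
theorem exists_linearMap_of_ker_le {R M N P : Type*} [Ring R] [AddCommGroup M] [Module R M]
    [AddCommGroup N] [Module R N] [AddCommGroup P] [Module R P] {π : N →ₗ[R] M}
    (hπ : Function.Surjective π) (g : N →ₗ[R] P) (h : LinearMap.ker π ≤ LinearMap.ker g) :
    ∃ f : M →ₗ[R] P, ∀ x, f (π x) = g x :=
  ⟨(LinearMap.ker π).liftQ g h ∘ₗ (π.quotKerEquivOfSurjective hπ).symm.toLinearMap, fun x => by
    have : (π.quotKerEquivOfSurjective hπ).symm (π x) = (LinearMap.ker π).mkQ x := by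
      rw [LinearEquiv.symm_apply_eq]
      rfl
    simp [this]⟩

/-- A finitely presented module has an endomorphism that looks like the right multiplication by
`y`, for every `y` that commutes with the finitely many coefficients of the relations. -/
theorem exists_rightMul_of_finitePresentation (R M : Type*) [Ring R] [AddCommGroup M] [Module R M]
    [Module.FinitePresentation R M] : ∃ (s : Finset M) (C : Finset R),
      Submodule.span R (s : Set M) = ⊤ ∧ ∀ y : R, (∀ c ∈ C, Commute c y) →
        ∃ ρ : Module.End R M, ∀ m ∈ s, ρ m = y • m := by
  classical
  obtain ⟨s, hs, T, hT⟩ := Module.FinitePresentation.out (R := R) (M := M)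
  set π := Finsupp.linearCombination R (Subtype.val : s → M) with hπ
  have hsurj : Function.Surjective π := by
    rw [← LinearMap.range_eq_top, hπ, Finsupp.range_linearCombination, Subtype.range_coe_subtype]
    exact hs
  refine ⟨s, (T ×ˢ s.attach).image fun x => x.1 x.2, hs, fun y hy => ?_⟩
  obtain ⟨ρ, hρ⟩ := exists_linearMap_of_ker_le hsurj
    (Finsupp.linearCombination R fun l : s => y • (l : M)) (by
    rw [← hT, Submodule.span_le]
    intro r hr
    have hr0 : π r = 0 := by
      have : r ∈ LinearMap.ker π := hT ▸ Submodule.subset_span hr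
      exact this
    rw [SetLike.mem_coe, LinearMap.mem_ker, Finsupp.linearCombination_apply, Finsupp.sum]
    rw [hπ, Finsupp.linearCombination_apply, Finsupp.sum] at hr0
    -- For a relation Σ r_l m_l = 0 one has Σ r_l y m_l = y Σ r_l m_l = 0, since `y` commutes with
    -- the r_l.
    rw [← smul_zero y, ← hr0, Finset.smul_sum]
    refine Finset.sum_congr rfl fun l _ => ?_
    rw [smul_smul, smul_smul, (hy (r l) (Finset.mem_image.2
      ⟨(r, l), Finset.mk_mem_product hr (Finset.mem_attach s l), rfl⟩)).eq])
  refine ⟨ρ, fun m hm => ?_⟩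
  simpa [hπ] using hρ (Finsupp.single ⟨m, hm⟩ 1)

theorem exists_level_rightMul (p : ℕ) [Fact p.Prime] (K : Type*) [Field K] [CharP K p] (n : ℕ)
    (M : Type*) [AddCommGroup M] [Module (DPn K n) M] [Module.FinitePresentation (DPn K n) M] :
    ∃ (s : Finset M) (k : ℕ) (ρ : Fin n → Module.End (DPn K n) M),
      Submodule.span (DPn K n) (s : Set M) = ⊤ ∧ (∀ i j, Commute (ρ i) (ρ j)) ∧
      ∀ m ∈ s, ∀ j, ρ j m = frobX K n p k j • m := by
  obtain ⟨s, C, hs, hC⟩ := exists_rightMul_of_finitePresentation (DPn K n) M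
  choose o ho using fun d : DPn K n => d.2
  -- The level is the largest order occurring among the coefficients; it suffices because k < p^k.
  choose ρ hρ using fun j => hC (frobX K n p (C.sup o) j) fun c hc => sub_eq_zero.1
    (mem_levelOp.1 (mem_levelOp_of_lt (diffOpOrder_mono (Finset.le_sup hc) (ho c))
      (Nat.lt_pow_self (Fact.out : p.Prime).one_lt)) j)
  refine ⟨s, C.sup o, ρ, hs, fun i j => LinearMap.ext_on hs fun m hm => ?_, fun m hm j => hρ j m hm⟩
  rw [Module.End.mul_apply, Module.End.mul_apply, hρ j m hm, hρ i m hm, map_smul, map_smul,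
    hρ j m hm, hρ i m hm, smul_smul, smul_smul, (frobX_commute K p _ i j).eq]

end Presentation

/-! ### Growth of finitely presented modules -/

section HilbertFunction

variable {K : Type*} [Field K] {n : ℕ} {M : Type*} [AddCommGroup M] [Module K M]
  [Module (DPn K n) M] [IsScalarTower K (DPn K n) M] {p k : ℕ}
  {ρ : Fin n → Module.End (DPn K n) M} {M₀ : Submodule K M}

/-- ρ_j is linear over the whole ring and operators of level `k` commute with x_j^(p^k), so the
identity passes from M₀ to its orbit under them. -/
theorem levelOp_smul_apply (hM : ∀ m ∈ M₀, ∀ j, ρ j m = frobX K n p k j • m) {m : M}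
    (hm : m ∈ (Subalgebra.toSubmodule (levelOp K n p k) • M₀ : Submodule K M)) (j : Fin n) :
    ρ j m = frobX K n p k j • m := by
  induction hm using Submodule.smul_induction_on' with
  | smul d hd m hm =>
    have hc : d * frobX K n p k j = frobX K n p k j * d := sub_eq_zero.1 (mem_levelOp.1 hd j)
    rw [map_smul, hM m hm, smul_smul, smul_smul, hc]
  | add x _ y _ hx hy => rw [map_add, smul_add, hx, hy]

variable [Fact p.Prime] [CharP K p]

theorem pow_mul_finrank_le_hilbertFunction (hρ : ∀ i j, Commute (ρ i) (ρ j))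
    (hM : ∀ m ∈ M₀, ∀ j, ρ j m = frobX K n p k j • m) [FiniteDimensional K M₀]
    {W : Submodule K M} [FiniteDimensional K W]
    (hW : W ≤ Subalgebra.toSubmodule (levelOp K n p k) • M₀) {l : ℕ}
    (hWl : W ≤ canonicalFiltration K n l • M₀) (m : ℕ) :
    (m + 1) ^ n * Module.finrank K W ≤
      hilbertFunction (canonicalFiltration K n) M₀ (n * (p ^ k * m) + l) := by
  have h := isDividedPowerSystem_divOp K p k hρ
  have hfd : FiniteDimensional K
      (canonicalFiltration K n (n * (p ^ k * m) + l) • M₀ : Submodule K M) :=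
    finiteDimensional_smul (finite_canonicalFiltration _) inferInstance
  rw [← card_Iic_constExp]
  refine h.card_mul_finrank_le _ (fun v hv j => ?_) fun β hβ v hv => ?_
  · have := levelOp_smul_apply hM (hW hv) j
    simp [this]
  · have hdeg : (p ^ k • β).degree ≤ n * (p ^ k * m) := by
      rw [Finsupp.degree_eq_sum]
      refine (Finset.sum_le_card_nsmul _ _ (p ^ k * m) fun j _ => ?_).trans (by simp)
      have : β j ≤ m := Finsupp.le_def.1 (Finset.mem_Iic.1 hβ) j
      simpa using Nat.mul_le_mul_left _ this
    exact smul_mem_smul_of_mul_le (R := DPn K n) (F := canonicalFiltration K n (n * (p ^ k * m)))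
      (G := canonicalFiltration K n l) (canonicalFiltration_mul_le _ _)
      (divOp_mem_canonicalFiltration hdeg) (hWl hv)

variable (hρ : ∀ i j, Commute (ρ i) (ρ j)) (hM : ∀ m ∈ M₀, ∀ j, ρ j m = frobX K n p k j • m)

include hρ hM

/-- Bernstein's inequality for a finitely presented module. -/
theorem le_dimension_of_rightMul [Nontrivial M] (hM₀ : IsFiniteGenerating K n M₀) :
    (n : EReal) ≤ dimension K n M := by
  rw [dimension_eq (isStandardType_canonicalFiltration p) hM₀]
  have := hM₀.1
  have hpos : 0 < Module.finrank K M₀ := by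
    rw [Module.finrank_pos_iff, Submodule.nontrivial_iff_ne_bot]
    rintro rfl
    exact bot_ne_top (α := Submodule (DPn K n) M) (by simpa using hM₀.2)
  -- The case W = M₀. Placing M₀ in step `m` instead of step 0 adds 1 to the slope n p^k, which
  -- keeps it positive even when n = 0.
  refine le_trans (le_growthDegree (f := fun m => m ^ n) (Eventually.of_forall fun _ => le_rfl))
    (growthDegree_le (a := n * p ^ k + 1) (b := 0) (Nat.succ_pos _)
      (Eventually.of_forall fun m => ?_))
  have hle0 : M₀ ≤ canonicalFiltration K n m • M₀ := le_smul_of_one_mem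
    (canonicalFiltration_mono (Nat.zero_le m) one_mem_canonicalFiltration) M₀
  have hle1 : M₀ ≤ Subalgebra.toSubmodule (levelOp K n p k) • M₀ :=
    le_smul_of_one_mem (levelOp K n p k).one_mem M₀
  have h := pow_mul_finrank_le_hilbertFunction hρ hM hle1 hle0 m
  have e : (n * p ^ k + 1) * m + 0 = n * (p ^ k * m) + m := by ring
  rw [e]
  refine le_trans ?_ h
  calc m ^ n ≤ (m + 1) ^ n := Nat.pow_le_pow_left (Nat.le_succ m) n
    _ ≤ _ := Nat.le_mul_of_pos_right _ hpos

/-- The box of divided powers supplies the factor (m+1)^n, and a subspace `W` of dimension at least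
`m` supplies one more power of `m`. -/
theorem succ_le_dimension_of_rightMul (hM₀ : IsFiniteGenerating K n M₀)
    (hinf : ¬ FiniteDimensional K
      (Subalgebra.toSubmodule (levelOp K n p k) • M₀ : Submodule K M)) :
    ((n + 1 : ℕ) : EReal) ≤ dimension K n M := by
  rw [dimension_eq (isStandardType_canonicalFiltration p) hM₀]
  have hM₀fd := hM₀.1
  obtain ⟨l, hl⟩ := exists_le_finrank_of_not_finiteDimensional (R := DPn K n)
    (F := canonicalFiltration K n) (A := levelOp K n p k) canonicalFiltration_mono
    (exists_mem_canonicalFiltration p) one_mem_canonicalFiltration canonicalFiltration_mul_le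
    (finite_levelGenerators K n p k) (levelGenerators_subset K n p k) (levelOp_le_adjoin K n p k)
    hM₀fd hinf
  refine le_trans (le_growthDegree (f := fun m => m ^ (n + 1))
    (Eventually.of_forall fun _ => le_rfl))
    (growthDegree_le (a := n * p ^ k + l + 1) (b := 0) (Nat.succ_pos _)
      (Eventually.of_forall fun m => ?_))
  obtain ⟨W, hWfd, hWC, hWF, hW⟩ := hl m
  have hWF' : W ≤ canonicalFiltration K n ((l + 1) * m) • M₀ :=
    hWF.trans (Submodule.smul_mono (canonicalFiltration_mono
      (Nat.mul_le_mul_right m (Nat.le_succ l))) le_rfl)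
  have h := pow_mul_finrank_le_hilbertFunction hρ hM hWC hWF' m
  have e : (n * p ^ k + l + 1) * m + 0 = n * (p ^ k * m) + (l + 1) * m := by ring
  rw [e]
  refine le_trans ?_ h
  rw [pow_succ]
  exact Nat.mul_le_mul (Nat.pow_le_pow_left (Nat.le_succ m) n) hW

end HilbertFunction

/-! ### Holonomicity and the dimension -/

section Holonomic

variable {K : Type*} [Field K] {n : ℕ} {M : Type*} [AddCommGroup M] [Module K M]
  [Module (DPn K n) M] [IsScalarTower K (DPn K n) M] (p k : ℕ) [Fact p.Prime] [CharP K p]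
  {M₀ : Submodule K M}

/-- N = D_k M₀ is itself a finite dimensional generating space and is stable under D_k. Expanding
operators in the ∂^[p^k β] with coefficients in D_k on the right therefore lets only the number of
indices β grow. -/
theorem isHolonomic_of_finiteDimensional_levelOp_smul (hM₀ : IsFiniteGenerating K n M₀)
    (hfin : FiniteDimensional K
      (Subalgebra.toSubmodule (levelOp K n p k) • M₀ : Submodule K M)) :
    IsHolonomic K n M := by
  set C := Subalgebra.toSubmodule (levelOp K n p k)
  set N : Submodule K M := C • M₀ with hN
  have hle : M₀ ≤ N := le_smul_of_one_mem (levelOp K n p k).one_mem M₀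
  have hCN : ∀ d ∈ levelOp K n p k, ∀ x ∈ N, d • x ∈ N := fun d hd x hx =>
    smul_mem_smul_of_mul_le (Subalgebra.isIdempotentElem_toSubmodule _).le
      ((Subalgebra.mem_toSubmodule _).2 hd) hx
  have hgen : IsFiniteGenerating K n N :=
    ⟨hfin, top_le_iff.1 (hM₀.2 ▸ Submodule.span_mono hle)⟩
  have hbound : ∀ i, hilbertFunction (canonicalFiltration K n) N i ≤
      (i + 2) ^ n * Module.finrank K N := fun i => by
    -- Elements of F_i have order at most i + 1, so the indices run over the box [0, i+1]^n, with
    -- (i+2)^n points.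
    rw [show i + 2 = i + 1 + 1 from rfl, ← card_Iic_constExp]
    refine finrank_le_card_mul
      (E := fun β : Fin n →₀ ℕ => Algebra.lsmul K K M (divOp K (p ^ k • β))) _ fun u hu => ?_
    induction hu using Submodule.smul_induction_on' with
    | smul d hd x hx =>
      obtain ⟨w, hw, hsum⟩ := exists_eq_sum_divOp_mul_of_mem K p k
        (mem_diffOpOrder_of_mem_canonicalFiltration hd)
      refine ⟨fun β => w β • x, fun β => hCN _ (hw β) x hx, ?_⟩
      rw [hsum, Finset.sum_smul]
      exact Finset.sum_congr rfl fun β _ => mul_smul _ _ _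
    | add x _ y _ hx hy =>
      obtain ⟨w, hw, rfl⟩ := hx
      obtain ⟨w', hw', rfl⟩ := hy
      exact ⟨w + w', fun β => add_mem (hw β) (hw' β), by
        simp [Finset.sum_add_distrib]⟩
  refine ⟨canonicalFiltration K n, isStandardType_canonicalFiltration p, N, hgen,
    -- The added 1 makes the leading coefficient nonzero even if N = 0, so the degree is exactly
    -- `n`.
    Polynomial.C ((Module.finrank K N : ℚ) + 1) * (Polynomial.X + Polynomial.C 2) ^ n, ?_,
    Eventually.of_forall fun i => ?_⟩
  · rw [Polynomial.natDegree_C_mul (by positivity), Polynomial.natDegree_pow,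
      Polynomial.natDegree_X_add_C, mul_one]
  · have h1 : (hilbertFunction (canonicalFiltration K n) N i : ℚ) ≤
        (i + 2) ^ n * Module.finrank K N := by exact_mod_cast hbound i
    simp only [Polynomial.eval_mul, Polynomial.eval_C, Polynomial.eval_pow, Polynomial.eval_add,
      Polynomial.eval_X]
    have h2 : (0 : ℚ) ≤ ((i : ℚ) + 2) ^ n := by positivity
    linarith

theorem dimension_le_of_isHolonomic (h : IsHolonomic K n M) : dimension K n M ≤ n := by
  obtain ⟨F, hF, M₀, hM₀, q, hq, hle⟩ := h
  rw [dimension_eq hF hM₀]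
  exact (growthDegree_le_natDegree q hle).trans_eq (by rw [hq])

end Holonomic

end

/-! ### The equivalence -/

theorem mainTheorem12 (p : ℕ) [Fact p.Prime] (K : Type*) [Field K] [CharP K p] (n : ℕ)
    (M : Type*) [AddCommGroup M] [Module K M] [Module (DPn K n) M]
    [IsScalarTower K (DPn K n) M] [Nontrivial M] [Module.FinitePresentation (DPn K n) M] :
    List.TFAE [IsHolonomic K n M,
      dimension K n M = (n : EReal),
      dimension K n M < (n : EReal) + 1] := by
  obtain ⟨s, k, ρ, hs, hρ, hsρ⟩ := exists_level_rightMul p K n M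
  let M₀ : Submodule K M := Submodule.span K s
  have hM₀ : IsFiniteGenerating K n M₀ :=
    ⟨FiniteDimensional.span_finset K s,
      top_le_iff.1 (hs ▸ Submodule.span_mono Submodule.subset_span)⟩
  have hM : ∀ m ∈ M₀, ∀ j, ρ j m = frobX K n p k j • m := fun m hm j => by
    have hle : M₀ ≤ LinearMap.ker ((ρ j).restrictScalars K -
        Algebra.lsmul K K M (frobX K n p k j)) :=
      Submodule.span_le.2 fun x hx => by simp [hsρ x hx j]
    simpa [sub_eq_zero] using hle hm
  tfae_have 1 → 2 := fun h =>
    le_antisymm (dimension_le_of_isHolonomic h) (le_dimension_of_rightMul hρ hM hM₀)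
  tfae_have 2 → 3 := fun h => by
    rw [h]
    exact_mod_cast Nat.lt_succ_self n
  tfae_have 3 → 1 := fun h => by
    by_contra hnot
    -- A non-holonomic M has D_k M₀ infinite dimensional, which forces Dim M ≥ n + 1.
    refine absurd (succ_le_dimension_of_rightMul hρ hM hM₀ fun hfin =>
      hnot (isHolonomic_of_finiteDimensional_levelOp_smul p k hM₀ hfin)) (not_le.2 ?_)
    exact_mod_cast h
  tfae_finish
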